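/- Let $d\in\mathbb N$, $\pi(x,\omega)f(t)=e^{2\pi i\omega\cdot t}f(t-x)$, and let $\varphi_0$ be the $L^2$-normalised Gaussian on $\mathbb R^n$. Let $M^1(\mathbb R^n)$ be Feichtinger's algebra with norm $\|f\|_{M^1}=\int_{\mathbb R^{2n}}|\langle f,\pi(z)\varphi_0\rangle|\,dz$, and let $M^\infty(\mathbb R^n)$ be the space of bounded conjugate-linear functionals on $M^1(\mathbb R^n)$, with bracket $\langle u,g\rangle$ and with $\pi(z)$ extended by $\langle\pi(z)u,g\rangle=\langle u,\pi(z)^*g\rangle$. Let $\mathcal M^\infty$ be the space of the bounded operators $S:M^1(\mathbb R^d)\to M^\infty(\mathbb R^d)$ that have a Weyl symbol $\sigma_S\in M^\infty(\mathbb R^{2d})$, i.e. $\langle Sf,g\rangle=\langle\sigma_S,W(g,f)\rangle$ for all $f,g\in M^1(\mathbb R^d)$, where $W(f,g)(x,\omega)=\int_{\mathbb R^d}f(x+\tfrac t2)\overline{g(x-\tfrac t2)}e^{-2\pi i\omega\cdot t}\,dt$; it carries the norm $\|S\|_{\mathcal M^\infty}=\sup\{|\langle Sf,g\rangle|:\|f\|_{M^1}=\|g\|_{M^1}=1\}$.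 Let $\mathcal F_W(S)=\mathcal F_\Omega(\sigma_S)$ be the Fourier–Wigner transform, where $\mathcal F_\Omega F(z)=\int_{\mathbb R^{2d}}F(z')e^{-2\pi i\Omega(z,z')}\,dz'$ with $\Omega((x,\omega),(x',\omega'))=x'\cdot\omega-x\cdot\omega'$, extended to $M^\infty(\mathbb R^{2d})$ by duality. For $z,w\in\mathbb R^{2d}$ put $\alpha_z(S)=\pi(z)S\pi(z)^*$ and $\beta_w(S)=e^{-\pi i w_1\cdot w_2/2}\pi(\tfrac w2)S\pi(\tfrac w2)$. For a subset $L\subset\mathbb R^{2d}$, call $S$ $L$-translation invariant if $\alpha_z(S)=S$ for all $z\in L$, and $L$-modulation invariant if $\beta_w(S)=S$ for all $w\in L$. Let $Pf(t)=f(-t)$. **Theorem.** The map $\Theta(S)=SP$ is a self-inverse isometric (linear) isomorphism of $\mathcal M^\infty$ onto itself. For every full-rank lattice $\Lambda\subset\mathbb R^{2d}$ it maps the set of $\Lambda$-modulation invariant operators of $\mathcal M^\infty$ onto the set of $\tfrac12\Lambda$-translation invariant operators of $\mathcal M^\infty$, and vice versa. Moreover, for every $S\in\mathcal M^\infty$,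 in the sense of distributions in $M^\infty(\mathbb R^{2d})$, $$\mathcal F_W(\Theta(S))(2z)=2^{-d}\,\sigma_S(z),\qquad\text{i.e.}\qquad \sigma_S(z)=2^{d}\,\mathcal F_W(\Theta(S))(2z).$$ -/

import Mathlib

open MeasureTheory Real
open scoped ComplexConjugate FourierTransform Pointwise

set_option linter.unusedSectionVars false

noncomputable section

section STFT

variable {E : Type*} [NormedAddCommGroup E] [InnerProductSpace ℝ E] [FiniteDimensional ℝ E]
  [MeasurableSpace E] [BorelSpace E]

/-- The character `t ↦ e^{2πi ⟨ω, t⟩}`. -/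
def chr (ω t : E) : ℂ := Complex.exp ((2 * π * inner ℝ ω t : ℝ) * Complex.I)

variable (E) in
/-- The `L²`-normalised Gaussian `φ₀(t) = 2^{n/4} e^{-π |t|²}` on an `n`-dimensional space. -/
def gaussWindow (t : E) : ℂ :=
  ((2 ^ ((Module.finrank ℝ E : ℝ) / 4) * Real.exp (-π * ‖t‖ ^ 2) : ℝ) : ℂ)

/-- The short-time Fourier transform
`V_g f(x, ω) = ⟨f, π(x, ω) g⟩ = ∫ f(t) conj(g(t - x)) e^{-2πi ω·t} dt`. -/
def stft (g f : E → ℂ) (x ω : E) : ℂ := ∫ t, f t * conj (g (t - x)) * chr ω (-t)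

lemma norm_chr (ω t : E) : ‖chr ω t‖ = 1 := Complex.norm_exp_ofReal_mul_I _

lemma chr_ne_zero (ω t : E) : chr ω t ≠ 0 := Complex.exp_ne_zero _

lemma chr_add_right (ω s t : E) : chr ω (s + t) = chr ω s * chr ω t := by
  simp only [chr, inner_add_right, ← Complex.exp_add]
  congr 1; push_cast; ring

lemma chr_add_left (ω η t : E) : chr (ω + η) t = chr ω t * chr η t := by
  simp only [chr, inner_add_left, ← Complex.exp_add]
  congr 1; push_cast; ring

lemma chr_neg_left (ω t : E) : chr (-ω) t = chr ω (-t) := by simp [chr]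

lemma chr_comm (ω t : E) : chr ω t = chr t ω := by simp [chr, real_inner_comm]

lemma chr_mul_neg (ω t : E) : chr ω t * chr ω (-t) = 1 := by
  rw [← chr_add_right]; simp [chr]

lemma continuous_chr : Continuous fun p : E × E => chr p.1 p.2 := by
  unfold chr; fun_prop

@[fun_prop]
lemma Continuous.chr' {X : Type*} [TopologicalSpace X] {a b : X → E} (ha : Continuous a)
    (hb : Continuous b) : Continuous fun x => chr (a x) (b x) :=
  continuous_chr.comp (ha.prodMk hb)

lemma fourier_eq_chr (f : E → ℂ) (ω : E) : 𝓕 f ω = ∫ t, f t * chr ω (-t) := by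
  rw [Real.fourier_eq']
  refine integral_congr_ae (.of_forall fun t => ?_)
  simp only [chr, inner_neg_right, smul_eq_mul, real_inner_comm]
  rw [mul_comm]; congr 4; ring

variable (E) in
@[fun_prop]
lemma continuous_gaussWindow : Continuous (gaussWindow E) := by
  unfold gaussWindow; fun_prop

lemma conj_gaussWindow (t : E) : conj (gaussWindow E t) = gaussWindow E t := by
  unfold gaussWindow; exact Complex.conj_ofReal _

lemma gaussWindow_pos (t : E) : 0 < ‖gaussWindow E t‖ := by
  rw [gaussWindow, Complex.norm_real, norm_pos_iff]; positivity

lemma gaussWindow_neg (t : E) : gaussWindow E (-t) = gaussWindow E t := by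
  simp [gaussWindow]

lemma gaussWindow_isometry (A : E ≃ₗᵢ[ℝ] E) (t : E) :
    gaussWindow E (A t) = gaussWindow E t := by
  simp [gaussWindow]

lemma norm_gaussWindow_le (t : E) :
    ‖gaussWindow E t‖ ≤ 2 ^ ((Module.finrank ℝ E : ℝ) / 4) := by
  rw [gaussWindow, Complex.norm_real, Real.norm_of_nonneg (by positivity)]
  have h : Real.exp (-π * ‖t‖ ^ 2) ≤ 1 := by
    rw [Real.exp_le_one_iff]
    have := Real.pi_pos
    nlinarith [sq_nonneg ‖t‖, mul_nonneg this.le (sq_nonneg ‖t‖)]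
  exact mul_le_of_le_one_right (by positivity) h

lemma gaussWindow_eq (t : E) : gaussWindow E t =
    ((2 ^ ((Module.finrank ℝ E : ℝ) / 4) : ℝ) : ℂ) * Complex.exp (-(π : ℂ) * ‖t‖ ^ 2) := by
  simp [gaussWindow]

variable (E) in
lemma integrable_gaussWindow : Integrable (gaussWindow E) := by
  have h := GaussianFourier.integrable_cexp_neg_mul_sq_norm_add (V := E) (b := (π : ℂ))
    (by simpa using Real.pi_pos) 0 0
  simp only [zero_mul, add_zero] at h
  have h2 := h.const_mul ((2 ^ ((Module.finrank ℝ E : ℝ) / 4) : ℝ) : ℂ)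
  exact h2.congr (.of_forall fun t => (gaussWindow_eq t).symm)

lemma fourier_gaussWindow (ω : E) : 𝓕 (gaussWindow E) ω = gaussWindow E ω := by
  have h := fourier_gaussian_innerProductSpace (V := E) (b := (π : ℂ))
    (by simpa using Real.pi_pos) ω
  have e : gaussWindow E = ((2 ^ ((Module.finrank ℝ E : ℝ) / 4) : ℝ) : ℂ) •
      fun t : E => Complex.exp (-(π : ℂ) * ‖t‖ ^ 2) := by
    ext t; simp [gaussWindow_eq]
  have hpi : (π : ℂ) ≠ 0 := by exact_mod_cast Real.pi_ne_zero
  rw [gaussWindow_eq, e, fourier_eq_chr]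
  rw [fourier_eq_chr] at h
  simp only [Pi.smul_apply, smul_eq_mul, mul_assoc, integral_const_mul] at h ⊢
  rw [h, div_self hpi, Complex.one_cpow, one_mul]
  congr 2; field_simp

lemma integrable_mul_window {f : E → ℂ} (hf : Integrable f) (x : E) :
    Integrable fun t => f t * conj (gaussWindow E (t - x)) := by
  refine hf.mul_bdd (c := 2 ^ ((Module.finrank ℝ E : ℝ) / 4)) ?_ (.of_forall fun t => ?_)
  · exact (Complex.continuous_conj.comp
      ((continuous_gaussWindow E).comp (by fun_prop))).aestronglyMeasurable
  · rw [RCLike.norm_conj]; exact norm_gaussWindow_le _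

lemma integrable_stft_integrand {f : E → ℂ} (hf : Integrable f) (x ω : E) :
    Integrable fun t => f t * conj (gaussWindow E (t - x)) * chr ω (-t) := by
  refine (integrable_mul_window hf x).mul_bdd (c := 1) ?_ (.of_forall fun t => (norm_chr _ _).le)
  exact (show Continuous fun t : E => chr ω (-t) by fun_prop).aestronglyMeasurable

lemma stft_add {f g : E → ℂ} (hf : Integrable f) (hg : Integrable g) (x ω : E) :
    stft (gaussWindow E) (f + g) x ω
      = stft (gaussWindow E) f x ω + stft (gaussWindow E) g x ω := by
  simp only [stft]
  rw [← integral_add (integrable_stft_integrand hf x ω) (integrable_stft_integrand hg x ω)]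
  simp [add_mul]

lemma stft_smul (c : ℂ) (g f : E → ℂ) (x ω : E) : stft g (c • f) x ω = c * stft g f x ω := by
  simp only [stft, Pi.smul_apply, smul_eq_mul, mul_assoc, integral_const_mul]

lemma stft_eq_fourier (g f : E → ℂ) (x ω : E) :
    stft g f x ω = 𝓕 (fun t => f t * conj (g (t - x))) ω := by
  rw [fourier_eq_chr, stft]

lemma continuous_stft {f : E → ℂ} (hf : Integrable f) :
    Continuous fun p : E × E => stft (gaussWindow E) f p.1 p.2 := by
  unfold stft
  refine continuous_of_dominated (bound := fun t => ‖f t‖ * 2 ^ ((Module.finrank ℝ E : ℝ) / 4))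
    (fun p => (integrable_stft_integrand hf p.1 p.2).aestronglyMeasurable)
    (fun p => .of_forall fun t => ?_) (hf.norm.mul_const _) (.of_forall fun t => ?_)
  · rw [norm_mul, norm_mul, norm_chr, mul_one, RCLike.norm_conj]
    gcongr; exact norm_gaussWindow_le _
  · have h1 : Continuous fun p : E × E => gaussWindow E (t - p.1) := by fun_prop
    have h2 : Continuous fun p : E × E => chr p.2 (-t) := by fun_prop
    exact (continuous_const.mul (Complex.continuous_conj.comp h1)).mul h2

/-- Membership of a function in Feichtinger's algebra `M¹`: the short-time Fourier transform with
respect to the Gaussian window is in `L¹`. Elements of `M¹` have a unique continuous representative,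
which is integrable (and in `L²`), and we work with that representative. -/
structure MemM1 (f : E → ℂ) : Prop where
  continuous : Continuous f
  integrable : Integrable f
  integrable_stft : Integrable fun p : E × E => stft (gaussWindow E) f p.1 p.2

lemma MemM1.zero : MemM1 (0 : E → ℂ) :=
  ⟨continuous_const, integrable_zero _ _ _, by simp [stft]⟩

lemma MemM1.add {f g : E → ℂ} (hf : MemM1 f) (hg : MemM1 g) : MemM1 (f + g) :=
  ⟨hf.1.add hg.1, hf.2.add hg.2,
    (hf.3.add hg.3).congr (.of_forall fun p => (stft_add hf.2 hg.2 p.1 p.2).symm)⟩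

lemma MemM1.smul {f : E → ℂ} (c : ℂ) (hf : MemM1 f) : MemM1 (c • f) :=
  ⟨hf.1.const_smul c, hf.2.smul c, by simpa only [stft_smul] using hf.3.const_mul c⟩

/-- The `M¹`-norm of a function, the `L¹`-norm of its Gaussian short-time Fourier transform. -/
def m1Norm (f : E → ℂ) : ℝ := ∫ p : E × E, ‖stft (gaussWindow E) f p.1 p.2‖

lemma MemM1.eq_zero {f : E → ℂ} (hf : MemM1 f) (h : m1Norm f = 0) : f = 0 := by
  have h1 : (fun p : E × E => ‖stft (gaussWindow E) f p.1 p.2‖) =ᵐ[volume] 0 :=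
    (integral_eq_zero_iff_of_nonneg (fun _ => norm_nonneg _) hf.3.norm).1 h
  have h2 : (fun p : E × E => ‖stft (gaussWindow E) f p.1 p.2‖) = 0 :=
    (Continuous.ae_eq_iff_eq volume (continuous_stft hf.2).norm continuous_const).1 h1
  have h3 : 𝓕 (fun t => f t * conj (gaussWindow E (t - 0))) = 0 := by
    ext ω
    have := congrFun h2 (0, ω)
    simpa [stft_eq_fourier] using this
  have hc : Continuous fun t => f t * conj (gaussWindow E (t - 0)) :=
    hf.1.mul (Complex.continuous_conj.comp
      ((continuous_gaussWindow E).comp (by fun_prop)))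
  have h4 := hc.fourierInv_fourier_eq (integrable_mul_window hf.2 0)
    (by rw [h3]; exact integrable_zero _ _ _)
  rw [h3] at h4
  ext t
  have h5 := congrFun h4 t
  rw [Real.fourierInv_eq] at h5
  simp only [Pi.zero_apply, smul_zero, integral_zero] at h5
  have h6 : gaussWindow E t ≠ 0 := norm_pos_iff.1 (gaussWindow_pos _)
  simpa [h6] using h5.symm


lemma MemM1.transfer {f f' : E → ℂ} (hf : MemM1 f) (hc : Continuous f') (hi : Integrable f')
    {Φ : E × E → E × E} (hΦ : MeasurePreserving Φ)
    (h : ∀ p : E × E, ‖stft (gaussWindow E) f' p.1 p.2‖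
      = ‖stft (gaussWindow E) f (Φ p).1 (Φ p).2‖) :
    MemM1 f' ∧ m1Norm f' = m1Norm f := by
  refine ⟨⟨hc, hi, ?_⟩, ?_⟩
  · have h1 := hΦ.integrable_comp_of_integrable hf.3.norm
    refine Integrable.mono' h1 (continuous_stft hi).aestronglyMeasurable (.of_forall fun p => ?_)
    exact (h p).le
  · unfold m1Norm
    simp only [h]
    have := integral_map (μ := volume) hΦ.measurable.aemeasurable
      (f := fun p : E × E => ‖stft (gaussWindow E) f p.1 p.2‖)
      (by rw [hΦ.map_eq]; exact (continuous_stft hf.2).norm.aestronglyMeasurable)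
    rw [hΦ.map_eq] at this
    exact this.symm

/-- The time-frequency shift `π(x, ω) f(t) = e^{2πi ω·t} f(t - x)` on functions. -/
def tfShiftFun (x ω : E) (f : E → ℂ) (t : E) : ℂ := chr ω t * f (t - x)

lemma stft_tfShiftFun (g f : E → ℂ) (y η x ω : E) :
    stft g (tfShiftFun y η f) x ω = chr (η - ω) y * stft g f (x - y) (ω - η) := by
  simp only [stft, tfShiftFun]
  rw [← integral_const_mul, ← integral_add_right_eq_self _ y]
  refine integral_congr_ae (.of_forall fun t => ?_)
  simp only [add_sub_cancel_right, sub_eq_add_neg η, sub_eq_add_neg ω, chr_add_left,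
    neg_add, chr_add_right, chr_neg_left, neg_neg]
  rw [show t + y - x = t - (x - y) by abel]
  ring

lemma measurePreserving_sub_sub (y η : E) :
    MeasurePreserving fun p : E × E => (p.1 - y, p.2 - η) :=
  (measurePreserving_sub_right volume y).prod (measurePreserving_sub_right volume η)

lemma MemM1.tfShift {f : E → ℂ} (hf : MemM1 f) (y η : E) :
    MemM1 (tfShiftFun y η f) ∧ m1Norm (tfShiftFun y η f) = m1Norm f := by
  refine hf.transfer ?_ ?_ (measurePreserving_sub_sub y η) fun p => ?_
  · have := hf.1
    unfold tfShiftFun; fun_prop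
  · refine (hf.2.comp_sub_right y).bdd_mul (c := 1) ?_ (.of_forall fun t => (norm_chr _ _).le)
    exact (show Continuous fun t : E => chr η t by fun_prop).aestronglyMeasurable
  · rw [stft_tfShiftFun, norm_mul, norm_chr, one_mul]

lemma stft_comp_isometry (A : E ≃ₗᵢ[ℝ] E) (f : E → ℂ) (x ω : E) :
    stft (gaussWindow E) (f ∘ A) x ω = stft (gaussWindow E) f (A x) (A ω) := by
  have h := fourier_comp_linearIsometry A (fun t => f t * conj (gaussWindow E (t - A x))) ω
  rw [stft_eq_fourier, stft_eq_fourier, ← h]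
  refine congrArg (fun F : E → ℂ => 𝓕 F ω) (funext fun t => ?_)
  simp [← map_sub, gaussWindow_isometry]

lemma MemM1.comp_isometry {f : E → ℂ} (hf : MemM1 f) (A : E ≃ₗᵢ[ℝ] E) :
    MemM1 (f ∘ A) ∧ m1Norm (f ∘ A) = m1Norm f := by
  refine hf.transfer (hf.1.comp A.continuous) ?_
    (A.measurePreserving.prod A.measurePreserving) fun p => ?_
  · exact A.measurePreserving.integrable_comp_of_integrable hf.2
  · rw [stft_comp_isometry]; rfl

lemma fourier_modulated_window (x ω s : E) :
    𝓕 (fun t => conj (gaussWindow E (t - x)) * chr ω (-t)) s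
      = chr (ω + s) (-x) * gaussWindow E (s + ω) := by
  rw [← fourier_gaussWindow, fourier_eq_chr, fourier_eq_chr, ← integral_const_mul,
    ← integral_add_right_eq_self _ x]
  refine integral_congr_ae (.of_forall fun t => ?_)
  simp only [add_sub_cancel_right, conj_gaussWindow, chr_add_left, neg_add, chr_add_right]
  ring

lemma stft_fourier {f : E → ℂ} (hf : Integrable f) (x ω : E) :
    stft (gaussWindow E) (𝓕 f) x ω = chr ω (-x) * stft (gaussWindow E) f (-ω) x := by
  have hg : Integrable fun t => conj (gaussWindow E (t - x)) * chr ω (-t) := by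
    have h0 : Integrable fun t => conj (gaussWindow E (t - x)) := by
      simp only [conj_gaussWindow]; exact (integrable_gaussWindow E).comp_sub_right x
    refine h0.mul_bdd (c := 1) ?_ (.of_forall fun t => (norm_chr _ _).le)
    exact (show Continuous fun t : E => chr ω (-t) by fun_prop).aestronglyMeasurable
  have key := VectorFourier.integral_fourierIntegral_smul_eq_flip (μ := (volume : Measure E))
    (ν := (volume : Measure E)) (L := innerₗ E) Real.continuous_fourierChar
    (by simpa using continuous_inner) hf hg
  have e1 : ∀ s, VectorFourier.fourierIntegral Real.fourierChar (volume : Measure E)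
      (innerₗ E).flip (fun t => conj (gaussWindow E (t - x)) * chr ω (-t)) s
      = chr (ω + s) (-x) * gaussWindow E (s + ω) := by
    intro s
    rw [flip_innerₗ]
    exact fourier_modulated_window x ω s
  simp only [e1, smul_eq_mul] at key
  have e2 : stft (gaussWindow E) (𝓕 f) x ω
      = ∫ t, 𝓕 f t * (conj (gaussWindow E (t - x)) * chr ω (-t)) := by
    simp only [stft, mul_assoc]
  rw [e2]
  refine key.trans ?_
  rw [stft, ← integral_const_mul]
  refine integral_congr_ae (.of_forall fun s => ?_)
  have e3 : chr s (-x) = chr x (-s) := by rw [chr_comm, chr_neg_left]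
  simp only [conj_gaussWindow, sub_neg_eq_add, chr_add_left, e3]
  ring

lemma MemM1.fourier_integrable {f : E → ℂ} (hf : MemM1 f) : Integrable (𝓕 f) := by
  have h1 : Integrable fun ω : E => ∫ x : E, stft (gaussWindow E) f x ω :=
    hf.3.integral_prod_right
  have h2 : ∀ ω : E, ∫ x : E, stft (gaussWindow E) f x ω
      = (∫ x, gaussWindow E x) * 𝓕 f ω := by
    intro ω
    unfold stft
    rw [integral_integral_swap]
    · rw [fourier_eq_chr, ← integral_const_mul]
      refine integral_congr_ae (.of_forall fun t => ?_)
      simp only [conj_gaussWindow]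
      have : ∀ x, f t * gaussWindow E (t - x) * chr ω (-t)
          = gaussWindow E (t - x) * (f t * chr ω (-t)) := fun x => by ring
      simp only [this]
      rw [integral_mul_const, integral_sub_left_eq_self (gaussWindow E) volume t]
    · have h3 : Integrable (fun p : E × E => f p.2 * gaussWindow E (p.1 - p.2)) := by
        have := hf.2.convolution_integrand (ContinuousLinearMap.mul ℂ ℂ) (integrable_gaussWindow E)
        exact this
      have h4 : Integrable (fun p : E × E =>
          f p.2 * gaussWindow E (p.1 - p.2) * chr ω (-p.2)) := by
        refine h3.mul_bdd (c := 1) ?_ (.of_forall fun t => (norm_chr _ _).le)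
        exact (show Continuous fun p : E × E => chr ω (-p.2) by fun_prop).aestronglyMeasurable
      refine h4.congr (.of_forall fun p => ?_)
      simp only [Function.uncurry, conj_gaussWindow]
      rw [← gaussWindow_neg, neg_sub]
  have h3 : (∫ x, gaussWindow E x) ≠ 0 := by
    have h := fourier_gaussWindow (0 : E)
    rw [fourier_eq_chr] at h
    simp only [chr, inner_zero_left, mul_zero, Complex.ofReal_zero, zero_mul, Complex.exp_zero,
      mul_one] at h
    rw [h]; exact norm_pos_iff.1 (gaussWindow_pos _)
  simp only [h2] at h1
  exact (integrable_const_mul_iff (IsUnit.mk0 _ h3) _).1 h1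

lemma MemM1.fourier {f : E → ℂ} (hf : MemM1 f) :
    MemM1 (𝓕 f) ∧ m1Norm (𝓕 f) = m1Norm f := by
  have hmp : MeasurePreserving fun p : E × E => ((-p.2, p.1) : E × E) :=
    ((Measure.measurePreserving_neg volume).prod (MeasurePreserving.id volume)).comp
      Measure.measurePreserving_swap
  refine hf.transfer ?_ hf.fourier_integrable hmp fun p => ?_
  · exact VectorFourier.fourierIntegral_continuous Real.continuous_fourierChar
      (by simpa using continuous_inner) hf.2
  · rw [stft_fourier hf.2, norm_mul, norm_chr, one_mul]

/-- The inverse Fourier transform of the Gaussian `e^{-3π|s|²}`. -/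
lemma exists_gauss_kernel : ∃ κ : E → ℂ, Continuous κ ∧ Integrable κ ∧
    ∀ s : E, gaussWindow E ((2 : ℝ) • s) = gaussWindow E s * ∫ η, κ η * chr η s := by
  have hre : 0 < ((3 * π : ℝ) : ℂ).re := by rw [Complex.ofReal_re]; positivity
  have hi : ∀ b : ℂ, 0 < b.re → Integrable fun t : E => Complex.exp (-b * ‖t‖ ^ 2) := by
    intro b hb
    simpa using GaussianFourier.integrable_cexp_neg_mul_sq_norm_add (V := E) hb 0 0
  set ψ : E → ℂ := fun t => Complex.exp (-((3 * π : ℝ) : ℂ) * ‖t‖ ^ 2) with hψ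
  have hψc : Continuous ψ := by fun_prop
  have hF : 𝓕 ψ = fun w : E => (π / ((3 * π : ℝ) : ℂ)) ^ (Module.finrank ℝ E / 2 : ℂ) *
      Complex.exp (-((π / 3 : ℝ) : ℂ) * ‖w‖ ^ 2) := by
    ext w
    rw [hψ, fourier_gaussian_innerProductSpace hre w]
    have hpi : (π : ℂ) ≠ 0 := by exact_mod_cast Real.pi_ne_zero
    congr 2
    push_cast
    field_simp
  have hFi : Integrable (𝓕 ψ) := by
    rw [hF]
    refine (hi _ ?_).const_mul _
    rw [Complex.ofReal_re]; positivity
  refine ⟨𝓕 ψ, ?_, hFi, fun s => ?_⟩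
  · rw [hF]; fun_prop
  · have h := congrFun (hψc.fourierInv_fourier_eq (hi _ hre) hFi) s
    rw [Real.fourierInv_eq'] at h
    have h2 : ∫ η, 𝓕 ψ η * chr η s = ψ s := by
      rw [← h]
      refine integral_congr_ae (.of_forall fun η => ?_)
      simp only [chr, smul_eq_mul]
      ring
    rw [h2, gaussWindow_eq, gaussWindow_eq, hψ, mul_assoc, ← Complex.exp_add]
    congr 2
    simp only [norm_smul]
    push_cast
    norm_num
    ring

lemma stft_narrow {κ : E → ℂ} (hκi : Integrable κ)
    (h : ∀ s : E, gaussWindow E ((2 : ℝ) • s) = gaussWindow E s * ∫ η, κ η * chr η s)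
    {f : E → ℂ} (hf : Integrable f) (x ω : E) :
    ∫ t, f t * gaussWindow E ((2 : ℝ) • (t - x)) * chr ω (-t)
      = ∫ η, κ η * chr η (-x) * stft (gaussWindow E) f x (ω - η) := by
  have h1 : ∀ t, f t * gaussWindow E ((2 : ℝ) • (t - x)) * chr ω (-t)
      = ∫ η, κ η * chr η (-x) * (f t * conj (gaussWindow E (t - x)) * chr (ω - η) (-t)) := by
    intro t
    rw [h, show f t * (gaussWindow E (t - x) * ∫ η, κ η * chr η (t - x)) * chr ω (-t)
      = (f t * gaussWindow E (t - x) * chr ω (-t)) * ∫ η, κ η * chr η (t - x) by ring,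
      ← integral_const_mul]
    refine integral_congr_ae (.of_forall fun η => ?_)
    simp only [conj_gaussWindow, sub_eq_add_neg, chr_add_left, chr_add_right, chr_neg_left,
      neg_neg]
    ring
  simp only [h1]
  rw [integral_integral_swap]
  · simp only [integral_const_mul, stft]
  · have h2 : Integrable fun p : E × E => f p.1 * κ p.2 := hf.mul_prod hκi
    refine h2.mul_bdd (g := fun p : E × E => chr p.2 (-x) * (conj (gaussWindow E (p.1 - x)) *
      chr (ω - p.2) (-p.1))) (c := 2 ^ ((Module.finrank ℝ E : ℝ) / 4)) ?_
      (.of_forall fun p => ?_) |>.congr (.of_forall fun p => ?_)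
    · have h3 : Continuous fun p : E × E => gaussWindow E (p.1 - x) := by fun_prop
      have h4 : Continuous fun p : E × E => chr p.2 (-x) := by fun_prop
      have h5 : Continuous fun p : E × E => chr (ω - p.2) (-p.1) := by fun_prop
      exact (h4.mul ((Complex.continuous_conj.comp h3).mul h5)).aestronglyMeasurable
    · simp only [norm_mul, norm_chr, RCLike.norm_conj, one_mul, mul_one]
      exact norm_gaussWindow_le _
    · simp only [Function.uncurry]; ring

variable (E) in
lemma measurePreserving_half_double :
    MeasurePreserving fun p : E × E => ((2⁻¹ : ℝ) • p.1, (2 : ℝ) • p.2) := by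
  have h : ∀ r : ℝ, r ≠ 0 → MeasurePreserving (fun x : E => r • x) volume
      (ENNReal.ofReal |(r ^ Module.finrank ℝ E)⁻¹| • volume) := fun r hr =>
    ⟨measurable_const_smul r, Measure.map_addHaar_smul volume hr⟩
  have h2 := (h 2⁻¹ (by norm_num)).prod (h 2 (by norm_num))
  refine ⟨h2.measurable, h2.map_eq.trans ?_⟩
  rw [Measure.prod_smul_left, Measure.prod_smul_right, smul_smul,
    ← ENNReal.ofReal_mul (abs_nonneg _), ← abs_mul]
  simp [Measure.volume_eq_prod]

variable (E) in
lemma MemM1.exists_half : ∃ C : ℝ, ∀ f : E → ℂ, MemM1 f →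
    MemM1 (fun t => f ((2⁻¹ : ℝ) • t)) ∧ m1Norm (fun t => f ((2⁻¹ : ℝ) • t)) ≤ C * m1Norm f := by
  obtain ⟨κ, hκ, hκi, hk⟩ := exists_gauss_kernel (E := E)
  set n := Module.finrank ℝ E with hn
  refine ⟨2 ^ n * ∫ η, ‖κ η‖, fun f hf => ?_⟩
  have hi : Integrable fun t => f ((2⁻¹ : ℝ) • t) := hf.2.comp_smul (by norm_num)
  have hc : Continuous fun t => f ((2⁻¹ : ℝ) • t) := hf.1.comp (continuous_const_smul _)
  set G : E × E → ℂ := fun p => ∫ η, κ η * chr η (-p.1) *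
    stft (gaussWindow E) f p.1 (p.2 - η) with hG
  set K : E × E → ℝ := fun p => ∫ η, ‖κ η‖ * ‖stft (gaussWindow E) f p.1 (p.2 - η)‖ with hK
  have hKi : Integrable (fun q : (E × E) × E =>
      ‖κ q.2‖ * ‖stft (gaussWindow E) f q.1.1 (q.1.2 - q.2)‖) := by
    have hcont : Continuous (fun q : (E × E) × E =>
        ‖κ q.2‖ * ‖stft (gaussWindow E) f q.1.1 (q.1.2 - q.2)‖) := by
      have h1 := (continuous_stft hf.2).comp
        (show Continuous fun q : (E × E) × E => (q.1.1, q.1.2 - q.2) by fun_prop)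
      exact ((hκ.comp continuous_snd).norm).mul h1.norm
    rw [Measure.volume_eq_prod, integrable_prod_iff' hcont.aestronglyMeasurable]
    have hs : ∀ η : E, MeasurePreserving fun p : E × E => (p.1, p.2 - η) := fun η =>
      (MeasurePreserving.id volume).prod (measurePreserving_sub_right volume η)
    have hint : ∀ η : E, Integrable fun p : E × E =>
        ‖κ η‖ * ‖stft (gaussWindow E) f p.1 (p.2 - η)‖ := fun η =>
      ((hs η).integrable_comp_of_integrable hf.3.norm).const_mul _
    refine ⟨.of_forall hint, ?_⟩
    have hval : ∀ η : E, ∫ p : E × E, ‖‖κ η‖ * ‖stft (gaussWindow E) f p.1 (p.2 - η)‖‖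
        = ‖κ η‖ * m1Norm f := by
      intro η
      simp only [norm_mul, norm_norm, integral_const_mul, m1Norm]
      congr 1
      have := integral_map (μ := volume) (hs η).measurable.aemeasurable
        (f := fun p : E × E => ‖stft (gaussWindow E) f p.1 p.2‖)
        (by rw [(hs η).map_eq]; exact (continuous_stft hf.2).norm.aestronglyMeasurable)
      rw [(hs η).map_eq] at this
      exact this.symm
    simp only [hval]
    exact hκi.norm.mul_const _
  have hKint : Integrable K := hKi.integral_prod_left
  have hKval : ∫ p, K p = (∫ η, ‖κ η‖) * m1Norm f := by
    rw [hK, integral_integral_swap hKi, ← integral_mul_const]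
    refine integral_congr_ae (.of_forall fun η => ?_)
    have hs : MeasurePreserving fun p : E × E => (p.1, p.2 - η) :=
      (MeasurePreserving.id volume).prod (measurePreserving_sub_right volume η)
    simp only [integral_const_mul, m1Norm]
    congr 1
    have := integral_map (μ := volume) hs.measurable.aemeasurable
      (f := fun p : E × E => ‖stft (gaussWindow E) f p.1 p.2‖)
      (by rw [hs.map_eq]; exact (continuous_stft hf.2).norm.aestronglyMeasurable)
    rw [hs.map_eq] at this
    exact this.symm
  have hm := measurePreserving_half_double E
  have hst : ∀ p : E × E, stft (gaussWindow E) (fun t => f ((2⁻¹ : ℝ) • t)) p.1 p.2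
      = 2 ^ n * G ((2⁻¹ : ℝ) • p.1, (2 : ℝ) • p.2) := by
    intro p
    simp only [hG]
    rw [← stft_narrow hκi hk hf.2]
    have h1 := Measure.integral_comp_inv_smul (volume : Measure E)
      (fun t => f t * gaussWindow E ((2 : ℝ) • (t - (2⁻¹ : ℝ) • p.1)) * chr ((2 : ℝ) • p.2) (-t)) 2
    rw [abs_of_pos (by positivity)] at h1
    rw [Complex.real_smul] at h1
    push_cast at h1
    rw [hn, ← h1, stft]
    refine integral_congr_ae (.of_forall fun t => ?_)
    simp only [conj_gaussWindow]
    rw [← smul_sub, smul_smul]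
    norm_num
    left
    simp only [chr, inner_neg_right, inner_smul_left, inner_smul_right]
    simp
  have hle : ∀ p : E × E, ‖stft (gaussWindow E) (fun t => f ((2⁻¹ : ℝ) • t)) p.1 p.2‖
      ≤ 2 ^ n * K ((2⁻¹ : ℝ) • p.1, (2 : ℝ) • p.2) := by
    intro p
    rw [hst, norm_mul]
    have : ‖(2 : ℂ) ^ n‖ = 2 ^ n := by simp
    rw [this]
    gcongr
    refine (norm_integral_le_integral_norm _).trans (le_of_eq ?_)
    simp only [hK, norm_mul, norm_chr, mul_one]
  have hdom : Integrable fun p : E × E => 2 ^ n * K ((2⁻¹ : ℝ) • p.1, (2 : ℝ) • p.2) :=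
    (hm.integrable_comp_of_integrable hKint).const_mul _
  have h3 : MemM1 (fun t => f ((2⁻¹ : ℝ) • t)) :=
    ⟨hc, hi, hdom.mono' (continuous_stft hi).aestronglyMeasurable (.of_forall hle)⟩
  refine ⟨h3, ?_⟩
  have h4 : ∫ p : E × E, K ((2⁻¹ : ℝ) • p.1, (2 : ℝ) • p.2) = ∫ p, K p := by
    have := integral_map (μ := volume) hm.measurable.aemeasurable (f := K)
      (by rw [hm.map_eq]; exact hKint.aestronglyMeasurable)
    rw [hm.map_eq] at this
    exact this.symm
  calc m1Norm (fun t => f ((2⁻¹ : ℝ) • t))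
      ≤ ∫ p : E × E, 2 ^ n * K ((2⁻¹ : ℝ) • p.1, (2 : ℝ) • p.2) :=
        integral_mono h3.3.norm hdom hle
    _ = 2 ^ n * (∫ η, ‖κ η‖) * m1Norm f := by
        rw [integral_const_mul, h4, hKval, mul_assoc]

end STFT

section FeichtingerAlgebra

variable (E : Type*) [NormedAddCommGroup E] [InnerProductSpace ℝ E] [FiniteDimensional ℝ E]
  [MeasurableSpace E] [BorelSpace E]

/-- Feichtinger's algebra `M¹(E)` (each of its elements being represented by its unique
continuous representative, which is automatically integrable). -/
def M1 : Type _ :=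
  ({ carrier := {f : E → ℂ | MemM1 f}
     zero_mem' := MemM1.zero
     add_mem' := fun hf hg => hf.add hg
     smul_mem' := fun c _ hf => hf.smul c } : Submodule ℂ (E → ℂ))

namespace M1

instance : AddCommGroup (M1 E) := inferInstanceAs (AddCommGroup (Submodule.mk _ _))

instance : Module ℂ (M1 E) := inferInstanceAs (Module ℂ (Submodule.mk _ _))

variable {E}

instance : CoeFun (M1 E) (fun _ => E → ℂ) := ⟨fun f => f.1⟩

lemma memM1 (f : M1 E) : MemM1 (f : E → ℂ) := f.2

/-- A function in `M¹` as an element of the type `M1 E`. -/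
def mk (f : E → ℂ) (hf : MemM1 f) : M1 E := ⟨f, hf⟩

@[simp] lemma coe_mk (f : E → ℂ) (hf : MemM1 f) : (mk f hf : E → ℂ) = f := rfl

@[simp] lemma coe_add (f g : M1 E) : ((f + g : M1 E) : E → ℂ) = (f : E → ℂ) + g := rfl

@[simp] lemma coe_smul (c : ℂ) (f : M1 E) : ((c • f : M1 E) : E → ℂ) = c • (f : E → ℂ) := rfl

@[simp] lemma coe_neg (f : M1 E) : ((-f : M1 E) : E → ℂ) = -(f : E → ℂ) := rfl

@[simp] lemma coe_zero : ((0 : M1 E) : E → ℂ) = 0 := rfl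

@[ext] lemma ext {f g : M1 E} (h : ∀ t, (f : E → ℂ) t = (g : E → ℂ) t) : f = g :=
  Subtype.ext (funext h)

instance : NormedAddCommGroup (M1 E) :=
  AddGroupNorm.toNormedAddCommGroup
    { toFun := fun f => m1Norm (f : E → ℂ)
      map_zero' := by simp [m1Norm, stft]
      add_le' := fun f g => by
        unfold m1Norm
        rw [← integral_add f.2.3.norm g.2.3.norm]
        refine integral_mono (f + g).2.3.norm (f.2.3.norm.add g.2.3.norm) fun p => ?_
        simp only [coe_add, stft_add f.2.2 g.2.2]
        exact norm_add_le _ _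
      neg' := fun f => by
        have h : ((-f : M1 E) : E → ℂ) = (-1 : ℂ) • (f : E → ℂ) := by simp
        rw [h]
        simp only [m1Norm, stft_smul, norm_mul, norm_neg, norm_one, one_mul]
      eq_zero_of_map_eq_zero' := fun f hf => by
        apply Subtype.ext
        exact MemM1.eq_zero f.2 hf }

/-- The norm of `M¹(E)` is `‖f‖ = ‖V_{φ₀} f‖_{L¹}`. -/
lemma norm_def (f : M1 E) :
    ‖f‖ = ∫ p : E × E, ‖stft (gaussWindow E) (f : E → ℂ) p.1 p.2‖ := rfl

instance : NormedSpace ℂ (M1 E) where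
  norm_smul_le c f := by
    simp only [norm_def, coe_smul, stft_smul, norm_mul, integral_const_mul, le_refl]

/-- The parity operator `P f(t) = f(-t)` on `M¹(E)`. -/
def parity : M1 E →L[ℂ] M1 E :=
  LinearMap.mkContinuous
    { toFun := fun f => mk (fun t => f (-t)) (f.2.comp_isometry (LinearIsometryEquiv.neg ℝ)).1
      map_add' := fun _ _ => rfl
      map_smul' := fun _ _ => rfl } 1
    (fun f => by
      rw [one_mul]; exact (f.2.comp_isometry (LinearIsometryEquiv.neg ℝ)).2.le)

@[simp] lemma parity_apply (f : M1 E) (t : E) : (parity f : E → ℂ) t = f (-t) := rfl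

/-- Composition `f ↦ f ∘ A` with a linear isometry on `M¹(E)`. -/
def compIsometry (A : E ≃ₗᵢ[ℝ] E) : M1 E →L[ℂ] M1 E :=
  LinearMap.mkContinuous
    { toFun := fun f => mk (fun t => f (A t)) (f.2.comp_isometry A).1
      map_add' := fun _ _ => rfl
      map_smul' := fun _ _ => rfl } 1
    (fun f => by rw [one_mul]; exact (f.2.comp_isometry A).2.le)

@[simp] lemma compIsometry_apply (A : E ≃ₗᵢ[ℝ] E) (f : M1 E) (t : E) :
    (compIsometry A f : E → ℂ) t = f (A t) := rfl

/-- The Fourier transform on `M¹(E)`. -/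
def fourier : M1 E →L[ℂ] M1 E :=
  LinearMap.mkContinuous
    { toFun := fun f => mk (𝓕 (f : E → ℂ)) f.2.fourier.1
      map_add' := fun f g => by
        ext ω
        simp only [coe_mk, coe_add, Pi.add_apply, fourier_eq_chr, add_mul]
        refine integral_add ?_ ?_
        all_goals
          refine Integrable.mul_bdd (c := 1) (M1.memM1 _).2 ?_ (.of_forall fun t => (norm_chr _ _).le)
          exact (show Continuous fun t : E => chr ω (-t) by fun_prop).aestronglyMeasurable
      map_smul' := fun c f => by
        ext ω
        simp only [coe_mk, coe_smul, Pi.smul_apply, fourier_eq_chr, smul_eq_mul, mul_assoc,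
          integral_const_mul, RingHom.id_apply] } 1
    (fun f => by rw [one_mul]; exact f.2.fourier.2.le)

@[simp] lemma fourier_apply (f : M1 E) (ω : E) : (fourier f : E → ℂ) ω = 𝓕 (f : E → ℂ) ω := rfl

/-- The dilation `f ↦ f(·/2)` on `M¹(E)`. -/
def half : M1 E →L[ℂ] M1 E :=
  LinearMap.mkContinuousOfExistsBound
    { toFun := fun f => mk (fun t => f ((2⁻¹ : ℝ) • t))
        ((MemM1.exists_half E).choose_spec (f : E → ℂ) f.2).1
      map_add' := fun _ _ => rfl
      map_smul' := fun _ _ => rfl }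
    ⟨_, fun f => ((MemM1.exists_half E).choose_spec (f : E → ℂ) f.2).2⟩

@[simp] lemma half_apply (f : M1 E) (t : E) : (half f : E → ℂ) t = f ((2⁻¹ : ℝ) • t) := rfl

end M1

/-- `M^∞(E)`, the space of bounded conjugate-linear functionals on `M¹(E)`; `u g` is the bracket
`⟨u, g⟩_{M^∞, M¹}`, linear in `u` and conjugate-linear in `g` as the inner product of `L²`. -/
abbrev MInf : Type _ := M1 E →L⋆[ℂ] ℂ

variable {E}

/-- The operator `u ↦ (g ↦ ⟨u, A g⟩)` on `M^∞` dual to an operator `A` on `M¹`. -/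
def dualOp (A : M1 E →L[ℂ] M1 E) : MInf E →L[ℂ] MInf E :=
  (ContinuousLinearMap.compSL (M1 E) (M1 E) ℂ (RingHom.id ℂ) (starRingEnd ℂ)).flip A

@[simp] lemma dualOp_apply (A : M1 E →L[ℂ] M1 E) (u : MInf E) (g : M1 E) :
    dualOp A u g = u (A g) := rfl

/-- The dilated distribution `u(2·)`, that is
`⟨u(2·), Φ⟩ = 2^{-n} ⟨u, Φ(·/2)⟩` on an `n`-dimensional space. -/
def dilateTwo (u : MInf E) : MInf E :=
  ((2 : ℂ) ^ Module.finrank ℝ E)⁻¹ • dualOp M1.half u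

end FeichtingerAlgebra

section PhaseSpace

variable {E : Type*} [NormedAddCommGroup E] [InnerProductSpace ℝ E] [FiniteDimensional ℝ E]
  [MeasurableSpace E] [BorelSpace E]

variable (E) in
/-- Phase space `E × Ê ≅ E × E` with its Euclidean structure; `z = (x, ω) = (z.fst, z.snd)`. -/
abbrev Phase : Type _ := WithLp 2 (E × E)

/-- The symplectic form `Ω(z, z') = x'·ω - x·ω'`. -/
def sympl (z z' : Phase E) : ℝ := inner ℝ z'.fst z.snd - inner ℝ z.fst z'.snd

variable (E) in
/-- The rotation `(x, ω) ↦ (ω, -x)`, for which `Ω(z, z') = ⟨z', J z⟩`. -/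
def symplJ : Phase E ≃ₗᵢ[ℝ] Phase E where
  toFun z := WithLp.toLp 2 (z.snd, -z.fst)
  invFun z := WithLp.toLp 2 (-z.snd, z.fst)
  left_inv z := by
    apply (WithLp.equiv 2 (E × E)).injective; ext <;> simp
  right_inv z := by
    apply (WithLp.equiv 2 (E × E)).injective; ext <;> simp
  map_add' z w := by
    apply (WithLp.equiv 2 (E × E)).injective; ext <;> simp [add_comm]
  map_smul' c z := by
    apply (WithLp.equiv 2 (E × E)).injective; ext <;> simp
  norm_map' z := by simp [WithLp.prod_norm_eq_of_L2, add_comm]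

lemma inner_symplJ (z z' : Phase E) : inner ℝ z' (symplJ E z) = sympl z z' := by
  simp [symplJ, sympl, WithLp.prod_inner_apply, inner_neg_right, real_inner_comm, sub_eq_add_neg]

/-- The symplectic Fourier transform `F_Ω f(z) = ∫ f(z') e^{-2πi Ω(z, z')} dz'` of a function. -/
def symplFourierFun (f : Phase E → ℂ) (z : Phase E) : ℂ :=
  ∫ z', f z' * Complex.exp ((-2 * π * sympl z z' : ℝ) * Complex.I)

lemma symplFourierFun_eq (f : Phase E → ℂ) :
    symplFourierFun f = 𝓕 f ∘ symplJ E := by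
  ext z
  simp only [Function.comp_apply, Real.fourier_eq', symplFourierFun, inner_symplJ, smul_eq_mul,
    mul_comm]

/-- The symplectic Fourier transform `F_Ω` on `M¹(ℝ^{2d})`; by the next lemma it is given by the
integral above. -/
def symplFourierM1 : M1 (Phase E) →L[ℂ] M1 (Phase E) :=
  (M1.compIsometry (symplJ E)).comp M1.fourier

@[simp] lemma symplFourierM1_apply (f : M1 (Phase E)) (z : Phase E) :
    (symplFourierM1 f : Phase E → ℂ) z = symplFourierFun (f : Phase E → ℂ) z := by
  rw [symplFourierFun_eq]; rfl

/-- The symplectic Fourier transform extended to `M^∞(ℝ^{2d})` by duality,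
`⟨F_Ω u, Φ⟩ = ⟨u, F_Ω Φ⟩` (`F_Ω` is unitary and its own inverse, hence self-adjoint, on `L²`). -/
def symplFourier (u : MInf (Phase E)) : MInf (Phase E) := dualOp symplFourierM1 u

/-- The time-frequency shift `π(z) f(t) = e^{2πi ω·t} f(t - x)`, `z = (x, ω)`, on `M¹(E)`. -/
def tfShift (z : Phase E) : M1 E →L[ℂ] M1 E :=
  LinearMap.mkContinuous
    { toFun := fun f => M1.mk (tfShiftFun z.fst z.snd (f : E → ℂ)) (f.2.tfShift z.fst z.snd).1
      map_add' := fun f g => by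
        ext t; simp [tfShiftFun, mul_add]
      map_smul' := fun c f => by
        ext t; simp [tfShiftFun, mul_left_comm] } 1
    (fun f => by rw [one_mul]; exact (f.2.tfShift z.fst z.snd).2.le)

@[simp] lemma tfShift_apply (z : Phase E) (f : M1 E) (t : E) :
    (tfShift z f : E → ℂ) t = chr z.snd t * f (t - z.fst) := rfl

/-- The adjoint `π(z)* = e^{-2πi x·ω} π(-z)` of a time-frequency shift on `M¹(E)`. -/
def tfShiftAdj (z : Phase E) : M1 E →L[ℂ] M1 E :=
  Complex.exp ((-2 * π * inner ℝ z.fst z.snd : ℝ) * Complex.I) • tfShift (-z)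

/-- The time-frequency shift on `M^∞(E)`, `⟨π(z) u, g⟩ = ⟨u, π(z)* g⟩`. -/
def tfShiftInf (z : Phase E) : MInf E →L[ℂ] MInf E := dualOp (tfShiftAdj z)

/-- The operator translation `α_z(S) = π(z) S π(z)*`. -/
def opTranslate (z : Phase E) (S : M1 E →L[ℂ] MInf E) : M1 E →L[ℂ] MInf E :=
  (tfShiftInf z).comp (S.comp (tfShiftAdj z))

/-- The operator modulation `β_w(S) = e^{-πi w₁·w₂/2} π(w/2) S π(w/2)`. -/
def opModulate (w : Phase E) (S : M1 E →L[ℂ] MInf E) : M1 E →L[ℂ] MInf E :=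
  Complex.exp ((-π * inner ℝ w.fst w.snd / 2 : ℝ) * Complex.I) •
    (tfShiftInf ((2⁻¹ : ℝ) • w)).comp (S.comp (tfShift ((2⁻¹ : ℝ) • w)))

/-- `S` is `L`-translation invariant: `α_z(S) = S` for all `z ∈ L`. -/
def IsTranslationInvariant (L : Set (Phase E)) (S : M1 E →L[ℂ] MInf E) : Prop :=
  ∀ z ∈ L, opTranslate z S = S

/-- `S` is `L`-modulation invariant: `β_z(S) = S` for all `z ∈ L`. -/
def IsModulationInvariant (L : Set (Phase E)) (S : M1 E →L[ℂ] MInf E) : Prop :=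
  ∀ z ∈ L, opModulate z S = S

/-- The cross-Wigner distribution
`W(f, g)(x, ω) = ∫ f(x + t/2) conj(g(x - t/2)) e^{-2πi ω·t} dt`. -/
def wigner (f g : E → ℂ) (z : Phase E) : ℂ :=
  ∫ t, f (z.fst + (2⁻¹ : ℝ) • t) * conj (g (z.fst - (2⁻¹ : ℝ) • t)) *
    Complex.exp ((-2 * π * inner ℝ z.snd t : ℝ) * Complex.I)

/-- `σ ∈ M^∞(ℝ^{2d})` is a Weyl symbol of `S`, i.e. `S` is the Weyl quantisation of `σ`:
`⟨S f, g⟩ = ⟨σ, W(g, f)⟩` for all `f, g ∈ M¹`. Here `Φ` is `W(g, f)` as an element of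
`M¹(ℝ^{2d})`. -/
def IsWeylSymbol (S : M1 E →L[ℂ] MInf E) (σ : MInf (Phase E)) : Prop :=
  ∀ (f g : M1 E) (Φ : M1 (Phase E)), (∀ z, (Φ : Phase E → ℂ) z = wigner (g : E → ℂ) f z) →
    S f g = σ Φ

variable (E) in
/-- `𝓜^∞`, the space of operators with Weyl symbol in `M^∞(ℝ^{2d})`, inside the bounded operators
from `M¹` to `M^∞` and with the operator norm
`‖S‖ = sup {|⟨S f, g⟩| : ‖f‖_{M¹} = ‖g‖_{M¹} = 1}`. -/
def OpMInf : Submodule ℂ (M1 E →L[ℂ] MInf E) where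
  carrier := {S | ∃ σ : MInf (Phase E), IsWeylSymbol S σ}
  zero_mem' := ⟨0, fun _ _ _ _ => rfl⟩
  add_mem' := by
    rintro S T ⟨σ, hσ⟩ ⟨τ, hτ⟩
    exact ⟨σ + τ, fun f g Φ h => congrArg₂ (· + ·) (hσ f g Φ h) (hτ f g Φ h)⟩
  smul_mem' := by
    rintro c S ⟨σ, hσ⟩
    exact ⟨c • σ, fun f g Φ h => congrArg (c • ·) (hσ f g Φ h)⟩

instance : NormedAddCommGroup (OpMInf E) :=
  @Submodule.normedAddCommGroup ℂ (M1 E →L[ℂ] MInf E) _ _ _ (OpMInf E)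

instance : NormedSpace ℂ (OpMInf E) :=
  @Submodule.normedSpace ℂ ℂ _ _ _ (M1 E →L[ℂ] MInf E) _ _ _ _ (OpMInf E)

lemma OpMInf.norm_def (S : OpMInf E) : ‖S‖ = ‖(S : M1 E →L[ℂ] MInf E)‖ := rfl

lemma OpMInf.coe_add (S T : OpMInf E) :
    ((S + T : OpMInf E) : M1 E →L[ℂ] MInf E) = (S : M1 E →L[ℂ] MInf E) + T := rfl

lemma OpMInf.coe_smul (c : ℂ) (S : OpMInf E) :
    ((c • S : OpMInf E) : M1 E →L[ℂ] MInf E) = c • (S : M1 E →L[ℂ] MInf E) := rfl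

/-- The Weyl symbol `σ_S` of `S ∈ 𝓜^∞`. -/
def weylSymbol (S : OpMInf E) : MInf (Phase E) := S.2.choose

lemma isWeylSymbol_weylSymbol (S : OpMInf E) : IsWeylSymbol (S : M1 E →L[ℂ] MInf E) (weylSymbol S) :=
  S.2.choose_spec

/-- The Fourier–Wigner transform `F_W(S) = F_Ω(σ_S)` of `S ∈ 𝓜^∞`. -/
def fourierWigner (S : OpMInf E) : MInf (Phase E) := symplFourier (weylSymbol S)

end PhaseSpace

end

/-! The whole statement rests on how the reflection P interacts with time-frequency shifts and with
the Wigner distribution.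

Shifts: π(w/2)* is a phase times π(-w/2), and P turns π(-w/2) into π(w/2). The phase is the one
built into β_w, so α_{w/2}(SP) = β_w(S)P (`opTranslate_comp_parity`). Since P is an isometric
involution of M¹, right composition with P is an isometric involution on operators and exchanges the
two kinds of invariance.

Symbols: Fourier inversion gives W(g, Pf)(z) = 2^d (F_Ω W(g, f))(2z) (`symplFourierFun_wigner`).
Writing D for the operator Φ ↦ 2^d (F_Ω Φ)(2·), the functional Φ ↦ ⟨σ, DΦ⟩ is therefore a Weyl
symbol of SP whenever σ is one of S (`IsWeylSymbol.comp_parity`). Hence Θ preserves 𝓜^∞, and the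
final formula follows from D² = 1 and the bookkeeping of powers of 2.

The analytic work lies in the uniqueness of Weyl symbols (`IsWeylSymbol.unique`): `weylSymbol` is a
chosen symbol, so identifying the symbol of SP requires that there be only one. The Wigner
distributions of shifted Gaussians are, up to nonzero constants, all the time-frequency shifts of
one Gaussian on phase space. A functional vanishing on these shifts vanishes, because the inversion
formula of the short-time Fourier transform writes each element of M¹ as a Bochner integral of them.
That integral needs M¹ to be complete and z ↦ π(z)g to be norm continuous. -/

noncomputable section

/-! ### Embeddings of M¹ and its completeness -/

open Filter Topology in
/-- A pointwise convergent series of functions whose `L¹`-norms are summable. -/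
lemma integrable_of_hasSum_of_summable_integral_norm {α : Type*} [MeasurableSpace α]
    {μ : Measure α} {F : ℕ → α → ℂ} {G : α → ℂ} (hF : ∀ i, Integrable (F i) μ)
    (hs : Summable fun i => ∫ x, ‖F i x‖ ∂μ) (hG : ∀ x, HasSum (fun i => F i x) (G x)) :
    Integrable G μ ∧ ∫ x, ‖G x‖ ∂μ ≤ ∑' i, ∫ x, ‖F i x‖ ∂μ := by
  have hm : AEStronglyMeasurable G μ :=
    aestronglyMeasurable_of_tendsto_ae atTop (f := fun n x => ∑ i ∈ Finset.range n, F i x)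
      (fun n => Finset.aestronglyMeasurable_fun_sum _ fun i _ => (hF i).1)
      (.of_forall fun x => (hG x).tendsto_sum_nat)
  have hle : ∀ x, ‖G x‖ₑ ≤ ∑' i, ‖F i x‖ₑ := by
    intro x
    refine le_of_tendsto ((hG x).tendsto_sum_nat.enorm) (.of_forall fun n => ?_)
    exact (enorm_sum_le _ _).trans (ENNReal.sum_le_tsum _)
  -- In `ENNReal` sum and integral commute unconditionally, so this one bound yields both
  -- integrability and the norm estimate.
  have h1 : ∫⁻ x, ‖G x‖ₑ ∂μ ≤ ENNReal.ofReal (∑' i, ∫ x, ‖F i x‖ ∂μ) := by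
    calc ∫⁻ x, ‖G x‖ₑ ∂μ ≤ ∫⁻ x, ∑' i, ‖F i x‖ₑ ∂μ := lintegral_mono hle
      _ = ∑' i, ∫⁻ x, ‖F i x‖ₑ ∂μ := lintegral_tsum fun i => (hF i).1.enorm
      _ = ∑' i, ENNReal.ofReal (∫ x, ‖F i x‖ ∂μ) := by
        simp only [ofReal_integral_norm_eq_lintegral_enorm (hF _)]
      _ = _ := (ENNReal.ofReal_tsum_of_nonneg
        (fun i => integral_nonneg fun x => norm_nonneg _) hs).symm
  have hi : Integrable G μ := ⟨hm, h1.trans_lt ENNReal.ofReal_lt_top⟩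
  refine ⟨hi, ?_⟩
  rw [← ofReal_integral_norm_eq_lintegral_enorm hi] at h1
  exact (ENNReal.ofReal_le_ofReal_iff
    (tsum_nonneg fun i => integral_nonneg fun x => norm_nonneg _)).1 h1

section WeylCalculus

variable {E : Type*} [NormedAddCommGroup E] [InnerProductSpace ℝ E] [FiniteDimensional ℝ E]
  [MeasurableSpace E] [BorelSpace E]

/-- Fubini: integrating over all translates of the window leaves only its total mass. -/
lemma integral_stft_fst {f : E → ℂ} (hf : Integrable f) (ω : E) :
    ∫ x : E, stft (gaussWindow E) f x ω = (∫ x, gaussWindow E x) * 𝓕 f ω := by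
  unfold stft
  rw [integral_integral_swap]
  · rw [fourier_eq_chr, ← integral_const_mul]
    refine integral_congr_ae (.of_forall fun t => ?_)
    simp only [conj_gaussWindow]
    have : ∀ x, f t * gaussWindow E (t - x) * chr ω (-t)
        = gaussWindow E (t - x) * (f t * chr ω (-t)) := fun x => by ring
    simp only [this]
    rw [integral_mul_const, integral_sub_left_eq_self (gaussWindow E) volume t]
  · have h3 : Integrable (fun p : E × E => f p.2 * gaussWindow E (p.1 - p.2)) :=
      hf.convolution_integrand (ContinuousLinearMap.mul ℂ ℂ) (integrable_gaussWindow E)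
    have h4 : Integrable (fun p : E × E =>
        f p.2 * gaussWindow E (p.1 - p.2) * chr ω (-p.2)) := by
      refine h3.mul_bdd (c := 1) ?_ (.of_forall fun t => (norm_chr _ _).le)
      exact (show Continuous fun p : E × E => chr ω (-p.2) by fun_prop).aestronglyMeasurable
    refine h4.congr (.of_forall fun p => ?_)
    simp only [Function.uncurry, conj_gaussWindow]
    rw [← gaussWindow_neg, neg_sub]

variable (E) in
-- The Gaussian is its own Fourier transform, so its integral is its value 2^{n/4} at 0. The lower
-- bound 1 lets the embeddings below have constant 1.
lemma one_le_norm_integral_gaussWindow : 1 ≤ ‖∫ x, gaussWindow E x‖ := by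
  have h := fourier_gaussWindow (0 : E)
  rw [fourier_eq_chr] at h
  simp only [chr, inner_zero_left, mul_zero, Complex.ofReal_zero, zero_mul, Complex.exp_zero,
    mul_one] at h
  rw [h, gaussWindow, Complex.norm_real, Real.norm_of_nonneg (by positivity)]
  simp only [norm_zero, ne_eq, OfNat.ofNat_ne_zero, not_false_eq_true, zero_pow, mul_zero,
    Real.exp_zero, mul_one]
  exact Real.one_le_rpow (by norm_num) (by positivity)

lemma MemM1.integral_norm_fourier_le {f : E → ℂ} (hf : MemM1 f) :
    ∫ ω, ‖𝓕 f ω‖ ≤ m1Norm f := by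
  have h1 := hf.3.norm.integral_prod_right
  have h2 : ∀ ω, ‖𝓕 f ω‖ ≤ ∫ x, ‖stft (gaussWindow E) f x ω‖ := by
    intro ω
    calc ‖𝓕 f ω‖ ≤ ‖∫ x, gaussWindow E x‖ * ‖𝓕 f ω‖ :=
          le_mul_of_one_le_left (norm_nonneg _) (one_le_norm_integral_gaussWindow E)
      _ = ‖∫ x, stft (gaussWindow E) f x ω‖ := by rw [integral_stft_fst hf.2, norm_mul]
      _ ≤ _ := norm_integral_le_integral_norm _
  calc ∫ ω, ‖𝓕 f ω‖ ≤ ∫ ω, ∫ x, ‖stft (gaussWindow E) f x ω‖ :=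
        integral_mono hf.fourier_integrable.norm h1 h2
    _ = m1Norm f := (integral_prod_symm _ hf.3.norm).symm

lemma MemM1.fourierInv_fourier {f : E → ℂ} (hf : MemM1 f) : 𝓕⁻ (𝓕 f) = f :=
  hf.1.fourierInv_fourier_eq hf.2 hf.fourier_integrable

lemma MemM1.fourier_fourier {f : E → ℂ} (hf : MemM1 f) (t : E) : 𝓕 (𝓕 f) t = f (-t) := by
  have h := congrFun hf.fourierInv_fourier (-t)
  rwa [Real.fourierInv_eq_fourier_neg, neg_neg] at h

/-- By inversion, the sup norm is at most the L¹-norm of the Fourier transform. -/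
lemma MemM1.norm_apply_le {f : E → ℂ} (hf : MemM1 f) (t : E) : ‖f t‖ ≤ m1Norm f := by
  have h := hf.fourier_fourier (-t)
  rw [neg_neg, fourier_eq_chr] at h
  rw [← h]
  refine (norm_integral_le_integral_norm _).trans ?_
  simp only [norm_mul, norm_chr, mul_one]
  exact hf.integral_norm_fourier_le

/-- The bound on the Fourier transform is applied to 𝓕 f, which has the same M¹-norm; 𝓕 𝓕 f is f
reflected. -/
lemma MemM1.integral_norm_le {f : E → ℂ} (hf : MemM1 f) : ∫ t, ‖f t‖ ≤ m1Norm f := by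
  have h := hf.fourier.1.integral_norm_fourier_le
  simp only [hf.fourier_fourier, hf.fourier.2] at h
  rwa [integral_neg_eq_self (fun t => ‖f t‖)] at h

lemma M1.hasSum_stft {u : ℕ → M1 E} (hu : Summable fun n => ‖u n‖) {f : E → ℂ}
    (hf : ∀ t, HasSum (fun n => (u n : E → ℂ) t) (f t)) (x ω : E) :
    HasSum (fun n => stft (gaussWindow E) (u n : E → ℂ) x ω) (stft (gaussWindow E) f x ω) := by
  have h := hasSum_integral_of_summable_integral_norm (μ := volume)
    (F := fun n t => (u n : E → ℂ) t * conj (gaussWindow E (t - x)) * chr ω (-t))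
    (fun n => integrable_stft_integrand (u n).memM1.2 x ω) ?_
  · have e : stft (gaussWindow E) f x ω = ∫ t, ∑' n,
        (u n : E → ℂ) t * conj (gaussWindow E (t - x)) * chr ω (-t) := by
      refine integral_congr_ae (.of_forall fun t => ?_)
      simp only [tsum_mul_right, (hf t).tsum_eq]
    rw [e]; exact h
  · refine Summable.of_nonneg_of_le (fun n => integral_nonneg fun t => norm_nonneg _) (fun n => ?_)
      (hu.mul_right (2 ^ ((Module.finrank ℝ E : ℝ) / 4)))
    refine le_trans ?_ (mul_le_mul_of_nonneg_right (u n).memM1.integral_norm_le (by positivity))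
    rw [← integral_mul_const]
    refine integral_mono (integrable_stft_integrand (u n).memM1.2 x ω).norm
      ((u n).memM1.2.norm.mul_const _) fun t => ?_
    simp only [norm_mul, norm_chr, mul_one, RCLike.norm_conj]
    gcongr
    exact norm_gaussWindow_le _

lemma M1.coe_sum (u : ℕ → M1 E) (s : Finset ℕ) (t : E) :
    ((∑ i ∈ s, u i : M1 E) : E → ℂ) t = ∑ i ∈ s, (u i : E → ℂ) t := by
  classical
  induction s using Finset.induction_on with
  | empty => simp
  | insert a s ha ih => simp [Finset.sum_insert ha, ih]

lemma M1.integrable_norm_le_of_hasSum {u : ℕ → M1 E} (hu : Summable fun n => ‖u n‖) {f : E → ℂ}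
    (hf : ∀ t, HasSum (fun n => (u n : E → ℂ) t) (f t)) :
    Integrable (fun p : E × E => stft (gaussWindow E) f p.1 p.2) ∧ m1Norm f ≤ ∑' n, ‖u n‖ := by
  simp only [M1.norm_def] at hu ⊢
  exact integrable_of_hasSum_of_summable_integral_norm
    (F := fun n (p : E × E) => stft (gaussWindow E) (u n : E → ℂ) p.1 p.2)
    (fun n => (u n).memM1.3) hu (fun p => M1.hasSum_stft hu hf p.1 p.2)

/-- The three clauses of `MemM1` for the pointwise sum come from three bounds by the M¹-norm: sup
norm (continuity), L¹-norm (integrability) and the short-time Fourier transform itself. -/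
lemma M1.exists_hasSum {u : ℕ → M1 E} (hu : Summable fun n => ‖u n‖) :
    ∃ f : M1 E, ∀ t, HasSum (fun n => (u n : E → ℂ) t) ((f : E → ℂ) t) := by
  have hb : ∀ n t, ‖(u n : E → ℂ) t‖ ≤ ‖u n‖ := fun n t => (u n).memM1.norm_apply_le t
  have hsum : ∀ t, HasSum (fun n => (u n : E → ℂ) t) (∑' n, (u n : E → ℂ) t) := fun t =>
    (Summable.of_norm_bounded hu fun n => hb n t).hasSum
  have hs : Summable fun n => ∫ t, ‖(u n : E → ℂ) t‖ :=
    Summable.of_nonneg_of_le (fun n => integral_nonneg fun t => norm_nonneg _)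
      (fun n => (u n).memM1.integral_norm_le) hu
  have hi := (integrable_of_hasSum_of_summable_integral_norm
    (F := fun n t => (u n : E → ℂ) t) (fun n => (u n).memM1.2) hs hsum).1
  exact ⟨M1.mk _ ⟨continuous_tsum (fun n => (u n).memM1.1) hu hb, hi,
    (M1.integrable_norm_le_of_hasSum hu hsum).1⟩, hsum⟩

open Filter Topology in
-- It suffices to sum absolutely convergent series. The remainder after N terms is the pointwise sum
-- of the shifted series, so its norm is at most the tail of the series of norms.
instance M1.completeSpace : CompleteSpace (M1 E) := by
  refine NormedAddCommGroup.completeSpace_of_summable_imp_tendsto fun u hu => ?_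
  obtain ⟨f, hf⟩ := M1.exists_hasSum hu
  refine ⟨f, ?_⟩
  rw [tendsto_iff_norm_sub_tendsto_zero]
  refine squeeze_zero (fun _ => norm_nonneg _) (fun N => ?_)
    (tendsto_sum_nat_add fun n => ‖u n‖)
  have hN : Summable fun n => ‖u (n + N)‖ := (summable_nat_add_iff N).2 hu
  rw [norm_sub_rev]
  refine (M1.integrable_norm_le_of_hasSum hN fun t => ?_).2
  have h : ((f - ∑ i ∈ Finset.range N, u i : M1 E) : E → ℂ) t
      = (f : E → ℂ) t - ∑ i ∈ Finset.range N, (u i : E → ℂ) t := by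
    rw [← M1.coe_sum, sub_eq_add_neg]
    simp [sub_eq_add_neg]
  rw [h]
  exact (hasSum_nat_add_iff' N).2 (hf t)

/-! ### Inversion formula and density of time-frequency shifts -/

/-- Evaluation at a point as a bounded functional on `M¹(E)`. -/
def M1.eval (t : E) : M1 E →L[ℂ] ℂ :=
  LinearMap.mkContinuous
    { toFun := fun f => (f : E → ℂ) t
      map_add' := fun _ _ => rfl
      map_smul' := fun _ _ => rfl } 1
    (fun f => by rw [one_mul]; exact f.memM1.norm_apply_le t)

@[simp] lemma M1.eval_apply (t : E) (f : M1 E) : M1.eval t f = (f : E → ℂ) t := rfl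

open Filter Topology in
/-- A form of Scheffé's lemma. -/
lemma tendsto_integral_norm_sub_of_integral_norm_eq {α : Type*} [MeasurableSpace α]
    {μ : Measure α} {F : ℕ → α → ℂ} {G : α → ℂ} (hF : ∀ i, Integrable (F i) μ)
    (hG : Integrable G μ) (hn : ∀ i, ∫ x, ‖F i x‖ ∂μ = ∫ x, ‖G x‖ ∂μ)
    (h : ∀ x, Tendsto (fun i => F i x) atTop (𝓝 (G x))) :
    Tendsto (fun i => ∫ x, ‖F i x - G x‖ ∂μ) atTop (𝓝 0) := by
  -- The `F i` have no common majorant, but this combination lies between 0 and 2‖G‖.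
  have h1 : Tendsto (fun i => ∫ x, (‖F i x‖ + ‖G x‖ - ‖F i x - G x‖) ∂μ) atTop
      (𝓝 (∫ x, 2 * ‖G x‖ ∂μ)) := by
    refine tendsto_integral_of_dominated_convergence (fun x => 2 * ‖G x‖)
      (fun i => (((hF i).norm.add hG.norm).sub ((hF i).sub hG).norm).1) (hG.norm.const_mul 2)
      (fun i => .of_forall fun x => ?_) (.of_forall fun x => ?_)
    · have h2 := norm_sub_norm_le (F i x) (G x)
      have h3 := norm_sub_le (F i x) (G x)
      rw [Real.norm_of_nonneg (by linarith)]
      linarith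
    · have h2 := ((h x).norm.add_const ‖G x‖).sub ((h x).sub_const (G x)).norm
      simp only [sub_self, norm_zero, sub_zero] at h2
      rwa [two_mul]
  have h2 : ∀ i, ∫ x, (‖F i x‖ + ‖G x‖ - ‖F i x - G x‖) ∂μ
      = ∫ x, 2 * ‖G x‖ ∂μ - ∫ x, ‖F i x - G x‖ ∂μ := by
    intro i
    have h3 := integral_sub ((hF i).norm.add hG.norm) ((hF i).sub hG).norm
    simp only [Pi.add_apply, Pi.sub_apply] at h3
    rw [h3, integral_add (hF i).norm hG.norm, hn, integral_const_mul, two_mul]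
  simp only [h2] at h1
  simpa using (tendsto_const_nhds (x := ∫ x, 2 * ‖G x‖ ∂μ)).sub h1

lemma norm_tfShift (z : Phase E) (f : M1 E) : ‖tfShift z f‖ = ‖f‖ :=
  (f.2.tfShift z.fst z.snd).2

lemma M1.norm_sub_eq (f g : M1 E) : ‖f - g‖ = ∫ p : E × E,
    ‖stft (gaussWindow E) (f : E → ℂ) p.1 p.2 - stft (gaussWindow E) (g : E → ℂ) p.1 p.2‖ := by
  have h : ((f - g : M1 E) : E → ℂ) = (f : E → ℂ) + (-1 : ℂ) • (g : E → ℂ) := by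
    rw [sub_eq_add_neg]; simp
  rw [M1.norm_def, h]
  refine integral_congr_ae (.of_forall fun p => ?_)
  have hg : Integrable ((-1 : ℂ) • (g : E → ℂ)) := g.memM1.2.smul _
  simp only [stft_add f.memM1.2 hg, stft_smul]
  congr 1; ring

open Filter Topology in
-- Shifting preserves the norm, so the transforms of π(z)f all have the same L¹-norm and depend
-- continuously on z pointwise; Scheffé's lemma upgrades this to L¹-convergence along sequences.
lemma continuous_tfShift (f : M1 E) : Continuous fun z : Phase E => tfShift z f := by
  refine SeqContinuous.continuous fun z w hz => ?_
  rw [tendsto_iff_norm_sub_tendsto_zero]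
  simp only [Function.comp_apply, M1.norm_sub_eq]
  refine tendsto_integral_norm_sub_of_integral_norm_eq (fun i => (tfShift (z i) f).memM1.3)
    (tfShift w f).memM1.3 (fun i => ?_) fun p => ?_
  · rw [← M1.norm_def, ← M1.norm_def, norm_tfShift, norm_tfShift]
  · have hV := continuous_stft f.memM1.2
    have hV2 : Continuous fun z : Phase E =>
        chr (z.snd - p.2) z.fst * stft (gaussWindow E) (f : E → ℂ) (p.1 - z.fst) (p.2 - z.snd) :=
      Continuous.mul (by fun_prop) (hV.comp (f := fun z : Phase E => (p.1 - z.fst, p.2 - z.snd))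
        (by fun_prop))
    have h := (hV2.tendsto w).comp hz
    exact (h.congr fun i => (stft_tfShiftFun _ _ _ _ _ _).symm).trans_eq
      (congrArg 𝓝 (stft_tfShiftFun _ _ _ _ _ _).symm)

lemma integrable_stft_mul_tfShift {f g : E → ℂ} (hf : MemM1 f) (hg : MemM1 g) (t : E) :
    Integrable fun p : E × E => stft (gaussWindow E) f p.1 p.2 * tfShiftFun p.1 p.2 g t := by
  have hc := hg.1
  refine hf.3.mul_bdd (c := m1Norm g) ?_ (.of_forall fun p => ?_)
  · have : Continuous fun p : E × E => tfShiftFun p.1 p.2 g t := by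
      unfold tfShiftFun; fun_prop
    exact this.aestronglyMeasurable
  · rw [tfShiftFun, norm_mul, norm_chr, one_mul]
    exact hg.norm_apply_le _

/-- The inversion formula for the short-time Fourier transform. -/
lemma integral_stft_mul_tfShift {f g : E → ℂ} (hf : MemM1 f) (hg : MemM1 g) (t : E) :
    ∫ p : E × E, stft (gaussWindow E) f p.1 p.2 * tfShiftFun p.1 p.2 g t
      = (∫ x, gaussWindow E x * g x) * f t := by
  rw [Measure.volume_eq_prod, integral_prod _ (integrable_stft_mul_tfShift hf hg t)]
  -- For almost every x the slice V f(x, ·) is integrable, and it is the Fourier transform of f ·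
  -- φ₀(· - x); inversion at t gives the value.
  have h1 : ∀ᵐ x : E, ∫ ω, stft (gaussWindow E) f x ω * tfShiftFun x ω g t
      = f t * (gaussWindow E (t - x) * g (t - x)) := by
    filter_upwards [hf.3.prod_right_ae] with x hx
    have hc : Continuous fun t => f t * conj (gaussWindow E (t - x)) :=
      hf.1.mul (Complex.continuous_conj.comp ((continuous_gaussWindow E).comp (by fun_prop)))
    have e : 𝓕 (fun t => f t * conj (gaussWindow E (t - x)))
        = stft (gaussWindow E) f x := funext fun ω => (stft_eq_fourier _ _ _ _).symm
    have h2 := congrFun (hc.fourierInv_fourier_eq (integrable_mul_window hf.2 x)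
      (by rw [e]; exact hx)) t
    rw [e, Real.fourierInv_eq'] at h2
    simp only [conj_gaussWindow] at h2
    rw [← mul_assoc, ← h2, ← integral_mul_const]
    refine integral_congr_ae (.of_forall fun ω => ?_)
    simp only [tfShiftFun, chr, smul_eq_mul]
    ring
  rw [integral_congr_ae h1, integral_const_mul,
    integral_sub_left_eq_self (fun x => gaussWindow E x * g x) volume t, mul_comm]

/-- The bounded linear functional `f ↦ conj ⟨u, f⟩`. -/
def MInf.conjDual (u : MInf E) : M1 E →L[ℂ] ℂ :=
  LinearMap.mkContinuous
    { toFun := fun f => conj (u f)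
      map_add' := fun f g => by simp
      map_smul' := fun c f => by simp } ‖u‖
    (fun f => by simpa using u.le_opNorm f)

@[simp] lemma MInf.conjDual_apply (u : MInf E) (f : M1 E) : u.conjDual f = conj (u f) := rfl

/-- The time-frequency shifts of `g ∈ M¹` span a dense subspace of `M¹`, if `⟨φ₀, g⟩ ≠ 0`. -/
lemma MInf.eq_zero_of_tfShift {u : MInf E} {g : M1 E}
    (hg : ∫ x, gaussWindow E x * (g : E → ℂ) x ≠ 0) (h : ∀ z, u (tfShift z g) = 0) : u = 0 := by
  ext f
  set F : E × E → M1 E := fun p =>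
    stft (gaussWindow E) (f : E → ℂ) p.1 p.2 • tfShift (WithLp.toLp 2 p) g with hF
  have hFc : Continuous F := (continuous_stft f.memM1.2).smul
    ((continuous_tfShift g).comp (WithLp.prod_continuous_toLp 2 E E))
  have hFi : Integrable F := by
    refine (f.memM1.3.norm.mul_const ‖g‖).mono' hFc.aestronglyMeasurable (.of_forall fun p => ?_)
    rw [hF, norm_smul, norm_tfShift]
  -- Point evaluations are bounded on M¹ and separate its elements, so the pointwise inversion
  -- formula becomes an identity of Bochner integrals.
  have h1 : ∫ p, F p = (∫ x, gaussWindow E x * (g : E → ℂ) x) • f := by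
    ext t
    have h2 := (M1.eval t).integral_comp_comm hFi
    rw [M1.eval_apply] at h2
    rw [← h2, M1.coe_smul, Pi.smul_apply, smul_eq_mul,
      ← integral_stft_mul_tfShift f.memM1 g.memM1 t]
    rfl
  -- Conjugating makes u complex-linear, so that it passes under the integral.
  have h3 := u.conjDual.integral_comp_comm hFi
  rw [h1] at h3
  simpa [hF, h, hg] using h3

/-! ### Gaussians, Wigner distributions and uniqueness of the Weyl symbol -/

/-- Completing the square in b|t|² + π|t - x|², with centre πx/(b + π), makes the transform a
Gaussian in x times a Gaussian in ω times a unimodular factor. -/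
lemma memM1_gaussian {b : ℝ} (hb : 0 < b) :
    MemM1 fun t : E => Complex.exp (-(b : ℂ) * ‖t‖ ^ 2) := by
  have hi : ∀ c : ℝ, 0 < c → Integrable fun t : E => Complex.exp (-(c : ℂ) * ‖t‖ ^ 2) := by
    intro c hc
    simpa using GaussianFourier.integrable_cexp_neg_mul_sq_norm_add (V := E) (b := (c : ℂ))
      (by simpa using hc) 0 0
  have hπ := Real.pi_pos
  refine ⟨by fun_prop, hi b hb, ?_⟩
  set K : ℂ := ((2 ^ ((Module.finrank ℝ E : ℝ) / 4) : ℝ) : ℂ) with hK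
  have h1 : ∀ x ω : E, stft (gaussWindow E) (fun t : E => Complex.exp (-(b : ℂ) * ‖t‖ ^ 2)) x ω
      = K * Complex.exp (-((b * π / (b + π) : ℝ) : ℂ) * ‖x‖ ^ 2) *
        chr ω (-((π / (b + π)) • x)) *
        𝓕 (fun t : E => Complex.exp (-((b + π : ℝ) : ℂ) * ‖t‖ ^ 2)) ω := by
    intro x ω
    rw [stft, fourier_eq_chr, ← integral_add_right_eq_self _ ((π / (b + π)) • x),
      ← integral_const_mul]
    refine integral_congr_ae (.of_forall fun t => ?_)
    simp only [conj_gaussWindow]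
    simp only [gaussWindow_eq, ← hK, neg_add, chr_add_right]
    have e : Complex.exp (-(b : ℂ) * ‖t + (π / (b + π)) • x‖ ^ 2) *
        Complex.exp (-(π : ℂ) * ‖t + (π / (b + π)) • x - x‖ ^ 2)
        = Complex.exp (-((b * π / (b + π) : ℝ) : ℂ) * ‖x‖ ^ 2) *
          Complex.exp (-((b + π : ℝ) : ℂ) * ‖t‖ ^ 2) := by
      rw [← Complex.exp_add, ← Complex.exp_add]
      congr 1
      rw [show t + (π / (b + π)) • x - x = t + (-(b / (b + π))) • x by
        rw [add_sub_assoc]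
        congr 1
        nth_rewrite 2 [← one_smul ℝ x]
        rw [← sub_smul]
        congr 1
        field_simp
        ring]
      norm_cast
      rw [norm_add_sq_real, norm_add_sq_real, norm_smul, norm_smul, inner_smul_right,
        inner_smul_right, mul_pow, mul_pow, Real.norm_eq_abs, Real.norm_eq_abs, sq_abs, sq_abs]
      field_simp
      ring
    linear_combination (K * chr ω (-t) * chr ω (-((π / (b + π)) • x))) * e
  have h2 : ∀ ω : E, 𝓕 (fun t : E => Complex.exp (-((b + π : ℝ) : ℂ) * ‖t‖ ^ 2)) ω
      = (π / ((b + π : ℝ) : ℂ)) ^ (Module.finrank ℝ E / 2 : ℂ) *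
        Complex.exp (-((π ^ 2 / (b + π) : ℝ) : ℂ) * ‖ω‖ ^ 2) := by
    intro ω
    rw [fourier_gaussian_innerProductSpace (by rw [Complex.ofReal_re]; positivity)]
    congr 2
    push_cast
    ring
  simp only [h1, h2]
  have h3 := ((hi (b * π / (b + π)) (by positivity)).const_mul K).mul_prod
    ((hi (π ^ 2 / (b + π)) (by positivity)).const_mul
      ((π / ((b + π : ℝ) : ℂ)) ^ (Module.finrank ℝ E / 2 : ℂ)))
  refine (h3.mul_bdd (g := fun p : E × E => chr p.2 (-((π / (b + π)) • p.1))) (c := 1) ?_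
    (.of_forall fun p => (norm_chr _ _).le)).congr (.of_forall fun p => ?_)
  · exact (show Continuous fun p : E × E => chr p.2 (-((π / (b + π)) • p.1)) by
      fun_prop).aestronglyMeasurable
  · simp only
    ring

lemma wigner_eq_integral_chr (f g : E → ℂ) (z : Phase E) : wigner f g z =
    ∫ t, f (z.fst + (2⁻¹ : ℝ) • t) * conj (g (z.fst - (2⁻¹ : ℝ) • t)) * chr z.snd (-t) := by
  refine integral_congr_ae (.of_forall fun t => ?_)
  simp only [chr, inner_neg_right]
  congr 4; ring

lemma conj_chr (ω t : E) : conj (chr ω t) = chr ω (-t) := by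
  simp only [chr, ← Complex.exp_conj, map_mul, Complex.conj_ofReal, Complex.conj_I,
    inner_neg_right]
  congr 1; push_cast; ring

/-- The covariance property of the cross-Wigner distribution. -/
lemma wigner_tfShiftFun (f g : E → ℂ) (a b z : Phase E) :
    wigner (tfShiftFun (a.fst - (2⁻¹ : ℝ) • b.snd) (a.snd + (2⁻¹ : ℝ) • b.fst) f)
      (tfShiftFun (a.fst + (2⁻¹ : ℝ) • b.snd) (a.snd - (2⁻¹ : ℝ) • b.fst) g) z
      = chr a.snd (-b.snd) * tfShiftFun a b (wigner f g) z := by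
  rw [tfShiftFun, wigner_eq_integral_chr, wigner_eq_integral_chr, ← integral_const_mul,
    -- The two time shifts differ by `b.snd`; translating t by it recentres both arguments, and only
    -- the phase identity `e3` remains.
    ← integral_const_mul, ← integral_sub_right_eq_self _ b.snd]
  refine integral_congr_ae (.of_forall fun t => ?_)
  simp only [tfShiftFun, map_mul, conj_chr]
  have e1 : z.fst + (2⁻¹ : ℝ) • (t - b.snd) - (a.fst - (2⁻¹ : ℝ) • b.snd)
      = (z - a).fst + (2⁻¹ : ℝ) • t := by
    simp only [WithLp.sub_fst]; module
  have e2 : z.fst - (2⁻¹ : ℝ) • (t - b.snd) - (a.fst + (2⁻¹ : ℝ) • b.snd)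
      = (z - a).fst - (2⁻¹ : ℝ) • t := by
    simp only [WithLp.sub_fst]; module
  have e3 : chr (a.snd + (2⁻¹ : ℝ) • b.fst) (z.fst + (2⁻¹ : ℝ) • (t - b.snd)) *
      chr (a.snd - (2⁻¹ : ℝ) • b.fst) (-(z.fst - (2⁻¹ : ℝ) • (t - b.snd))) *
      chr z.snd (-(t - b.snd)) = chr a.snd (-b.snd) * chr b z * chr (z - a).snd (-t) := by
    simp only [chr, ← Complex.exp_add, ← add_mul]
    congr 2
    norm_cast
    simp only [WithLp.prod_inner_apply, WithLp.sub_snd, inner_add_left, inner_add_right,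
      inner_sub_left, inner_sub_right, inner_neg_right, inner_smul_left, inner_smul_right,
      WithLp.ofLp_fst, WithLp.ofLp_snd, real_inner_comm z.snd]
    simp
    ring
  rw [e1, e2]
  linear_combination (f ((z - a).fst + (2⁻¹ : ℝ) • t) *
    conj (g ((z - a).fst - (2⁻¹ : ℝ) • t))) * e3

/-- By the parallelogram law |x + t/2|² + |x - t/2|² = 2|x|² + |t|²/2, so the variables separate,
and the Fourier transform in t supplies the matching factor e^{-2π|ω|²}. -/
lemma wigner_gaussWindow : ∃ c : ℂ, c ≠ 0 ∧ ∀ z : Phase E,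
    wigner (gaussWindow E) (gaussWindow E) z = c * Complex.exp (-((2 * π : ℝ) : ℂ) * ‖z‖ ^ 2) := by
  have hπ := Real.pi_pos
  set K : ℂ := ((2 ^ ((Module.finrank ℝ E : ℝ) / 4) : ℝ) : ℂ) with hK
  refine ⟨K ^ 2 * (π / ((π / 2 : ℝ) : ℂ)) ^ (Module.finrank ℝ E / 2 : ℂ), ?_, fun z => ?_⟩
  · have h1 : K ≠ 0 := by
      rw [hK]; exact_mod_cast (by positivity : (2 : ℝ) ^ ((Module.finrank ℝ E : ℝ) / 4) ≠ 0)
    exact mul_ne_zero (pow_ne_zero 2 h1) (by simp [Complex.cpow_eq_zero_iff])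
  · have h1 : wigner (gaussWindow E) (gaussWindow E) z
        = K ^ 2 * Complex.exp (-((2 * π : ℝ) : ℂ) * ‖z.fst‖ ^ 2) *
          𝓕 (fun t : E => Complex.exp (-((π / 2 : ℝ) : ℂ) * ‖t‖ ^ 2)) z.snd := by
      rw [wigner_eq_integral_chr, fourier_eq_chr, ← integral_const_mul]
      refine integral_congr_ae (.of_forall fun t => ?_)
      simp only [conj_gaussWindow]
      simp only [gaussWindow_eq, ← hK]
      have e : Complex.exp (-(π : ℂ) * ‖z.fst + (2⁻¹ : ℝ) • t‖ ^ 2) *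
          Complex.exp (-(π : ℂ) * ‖z.fst - (2⁻¹ : ℝ) • t‖ ^ 2)
          = Complex.exp (-((2 * π : ℝ) : ℂ) * ‖z.fst‖ ^ 2) *
            Complex.exp (-((π / 2 : ℝ) : ℂ) * ‖t‖ ^ 2) := by
        rw [← Complex.exp_add, ← Complex.exp_add]
        congr 1
        norm_cast
        rw [norm_add_sq_real, norm_sub_sq_real, norm_smul, mul_pow, Real.norm_eq_abs, sq_abs]
        ring
      linear_combination (K ^ 2 * chr z.snd (-t)) * e
    rw [h1, fourier_gaussian_innerProductSpace (by rw [Complex.ofReal_re]; positivity)]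
    have e : Complex.exp (-((2 * π : ℝ) : ℂ) * ‖z.fst‖ ^ 2) *
        Complex.exp (-π ^ 2 * ‖z.snd‖ ^ 2 / ((π / 2 : ℝ) : ℂ))
        = Complex.exp (-((2 * π : ℝ) : ℂ) * ‖z‖ ^ 2) := by
      rw [← Complex.exp_add]
      congr 1
      norm_cast
      rw [WithLp.prod_norm_sq_eq_of_L2]
      field_simp
      ring
    rw [← e]
    ring

lemma memM1_gaussWindow : MemM1 (gaussWindow E) := by
  have h := (memM1_gaussian (E := E) Real.pi_pos).smul
    ((2 ^ ((Module.finrank ℝ E : ℝ) / 4) : ℝ) : ℂ)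
  have e : gaussWindow E = ((2 ^ ((Module.finrank ℝ E : ℝ) / 4) : ℝ) : ℂ) •
      fun t : E => Complex.exp (-(π : ℂ) * ‖t‖ ^ 2) := by
    ext t; simp [gaussWindow_eq]
  rwa [e]

/-- The cross-Wigner distributions in `M¹` span a dense subspace of `M¹`. -/
lemma MInf.eq_zero_of_wigner {u : MInf (Phase E)} (h : ∀ (f g : M1 E) (Φ : M1 (Phase E)),
    (∀ z, (Φ : Phase E → ℂ) z = wigner (g : E → ℂ) f z) → u Φ = 0) : u = 0 := by
  obtain ⟨c, hc, hW⟩ := wigner_gaussWindow (E := E)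
  set G : M1 (Phase E) := M1.mk _ (memM1_gaussian (E := Phase E) (b := 2 * π) (by positivity))
    with hG
  set φ : M1 E := M1.mk _ (memM1_gaussWindow (E := E)) with hφ
  refine MInf.eq_zero_of_tfShift (g := G) ?_ fun z => ?_
  -- The exponents π and 2π add up, so the pairing with the window is a Gaussian integral and does
  -- not vanish.
  · have e : ∀ x : Phase E, gaussWindow (Phase E) x * (G : Phase E → ℂ) x
        = ((2 ^ ((Module.finrank ℝ (Phase E) : ℝ) / 4) : ℝ) : ℂ) *
          Complex.exp (-((3 * π : ℝ) : ℂ) * ‖x‖ ^ 2) := by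
      intro x
      rw [gaussWindow_eq, hG, M1.coe_mk, mul_assoc, ← Complex.exp_add]
      congr 2
      push_cast
      ring
    have hπ := Real.pi_pos
    simp only [e]
    rw [integral_const_mul, GaussianFourier.integral_cexp_neg_mul_sq_norm
      (by rw [Complex.ofReal_re]; positivity)]
    refine mul_ne_zero ?_ (by simp [Complex.cpow_eq_zero_iff])
    exact_mod_cast (by positivity : (2 : ℝ) ^ ((Module.finrank ℝ (Phase E) : ℝ) / 4) ≠ 0)
  · set a := z.fst
    set b := z.snd
    -- These are the shifts for which the covariance property produces the prescribed shift by (a,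
    -- b).
    have h1 := h (tfShift (WithLp.toLp 2 (a.fst + (2⁻¹ : ℝ) • b.snd, a.snd - (2⁻¹ : ℝ) • b.fst)) φ)
      (tfShift (WithLp.toLp 2 (a.fst - (2⁻¹ : ℝ) • b.snd, a.snd + (2⁻¹ : ℝ) • b.fst)) φ)
      ((chr a.snd (-b.snd) * c) • tfShift z G) fun w => ?_
    · rw [map_smulₛₗ, smul_eq_mul, mul_eq_zero] at h1
      exact h1.resolve_left ((map_ne_zero _).2 (mul_ne_zero (chr_ne_zero _ _) hc))
    · refine Eq.trans ?_ (wigner_tfShiftFun (gaussWindow E) (gaussWindow E) a b w).symm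
      simp only [tfShiftFun, hW, M1.coe_smul, Pi.smul_apply, tfShift_apply, smul_eq_mul, hG,
        M1.coe_mk]
      ring

lemma IsWeylSymbol.unique {S : M1 E →L[ℂ] MInf E} {σ τ : MInf (Phase E)}
    (hσ : IsWeylSymbol S σ) (hτ : IsWeylSymbol S τ) : σ = τ := by
  rw [← sub_eq_zero]
  refine MInf.eq_zero_of_wigner fun f g Φ h => ?_
  rw [sub_apply, ← hσ f g Φ h, ← hτ f g Φ h, sub_self]

/-! ### Symplectic Fourier transform, dilation and reflection -/

variable (E) in
lemma finrank_phase : Module.finrank ℝ (Phase E) = 2 * Module.finrank ℝ E := by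
  rw [(WithLp.linearEquiv 2 ℝ (E × E)).finrank_eq, Module.finrank_prod, two_mul]

lemma fourier_comp_half (f : E → ℂ) (ω : E) :
    𝓕 (fun t => f ((2⁻¹ : ℝ) • t)) ω = 2 ^ Module.finrank ℝ E * 𝓕 f ((2 : ℝ) • ω) := by
  have h := Measure.integral_comp_inv_smul (volume : Measure E)
    (fun t => f t * chr ((2 : ℝ) • ω) (-t)) 2
  rw [abs_of_pos (by positivity), Complex.real_smul] at h
  push_cast at h
  rw [fourier_eq_chr, fourier_eq_chr, ← h]
  refine integral_congr_ae (.of_forall fun t => ?_)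
  simp [chr, inner_smul_left, inner_smul_right]

lemma symplFourierFun_half (f : Phase E → ℂ) (z : Phase E) :
    symplFourierFun (fun w => f ((2⁻¹ : ℝ) • w)) z
      = 2 ^ Module.finrank ℝ (Phase E) * symplFourierFun f ((2 : ℝ) • z) := by
  simp only [symplFourierFun_eq, Function.comp_apply, fourier_comp_half, map_smul]

/-- The rotation J commutes with 𝓕, and both 𝓕² and J² are reflections, which cancel. -/
lemma symplFourierM1_symplFourierM1 (Φ : M1 (Phase E)) :
    symplFourierM1 (symplFourierM1 Φ) = Φ := by
  ext z
  have e : ((symplFourierM1 Φ : M1 (Phase E)) : Phase E → ℂ)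
      = 𝓕 (Φ : Phase E → ℂ) ∘ symplJ E := by
    ext w; rw [symplFourierM1_apply, symplFourierFun_eq]
  have hJ : symplJ E (symplJ E z) = -z := by
    apply (WithLp.equiv 2 (E × E)).injective; ext <;> simp [symplJ]
  rw [symplFourierM1_apply, symplFourierFun_eq, e, Function.comp_apply,
    fourier_comp_linearIsometry, hJ, Φ.memM1.fourier_fourier, neg_neg]

/-- The operator `Φ ↦ 2^d (F_Ω Φ)(2·)` on `M¹(ℝ^{2d})`, which maps `W(g, f)` to `W(g, P f)`. -/
def symplFourierDouble : M1 (Phase E) →L[ℂ] M1 (Phase E) :=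
  ((2 : ℂ) ^ Module.finrank ℝ E)⁻¹ • symplFourierM1.comp M1.half

/-- Dilating by 1/2 before F_Ω costs a factor 2^{2d} on the 2d-dimensional phase space, which turns
the 2^{-d} of the definition into 2^d. -/
lemma symplFourierDouble_apply (Φ : M1 (Phase E)) (z : Phase E) :
    (symplFourierDouble Φ : Phase E → ℂ) z
      = 2 ^ Module.finrank ℝ E * symplFourierFun (Φ : Phase E → ℂ) ((2 : ℝ) • z) := by
  have h : (symplFourierDouble Φ : Phase E → ℂ) z = ((2 : ℂ) ^ Module.finrank ℝ E)⁻¹ *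
      symplFourierFun (fun w => (Φ : Phase E → ℂ) ((2⁻¹ : ℝ) • w)) z :=
    congrArg (((2 : ℂ) ^ Module.finrank ℝ E)⁻¹ * ·) (symplFourierM1_apply (M1.half Φ) z)
  rw [h, symplFourierFun_half, finrank_phase, two_mul, pow_add]
  field_simp

lemma half_symplFourierDouble (Φ : M1 (Phase E)) :
    M1.half (symplFourierDouble Φ) = (2 : ℂ) ^ Module.finrank ℝ E • symplFourierM1 Φ := by
  ext z
  simp [symplFourierDouble_apply, smul_smul]

lemma symplFourierDouble_symplFourierDouble (Φ : M1 (Phase E)) :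
    symplFourierDouble (symplFourierDouble Φ) = Φ := by
  have h : symplFourierDouble (symplFourierDouble Φ) = ((2 : ℂ) ^ Module.finrank ℝ E)⁻¹ •
      symplFourierM1 (M1.half (symplFourierDouble Φ)) := rfl
  rw [h, half_symplFourierDouble, map_smul, symplFourierM1_symplFourierM1, smul_smul,
    inv_mul_cancel₀ (pow_ne_zero _ two_ne_zero), one_smul]

lemma symplFourierM1_half (Φ : M1 (Phase E)) :
    symplFourierM1 (M1.half Φ) = (2 : ℂ) ^ Module.finrank ℝ E • symplFourierDouble Φ := by
  have h : symplFourierDouble Φ = ((2 : ℂ) ^ Module.finrank ℝ E)⁻¹ •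
      symplFourierM1 (M1.half Φ) := rfl
  rw [h, smul_smul, mul_inv_cancel₀ (pow_ne_zero _ two_ne_zero), one_smul]

lemma integrable_wigner_integrand (f g : M1 E) (x : E) : Integrable fun t =>
    (f : E → ℂ) (x + (2⁻¹ : ℝ) • t) * conj ((g : E → ℂ) (x - (2⁻¹ : ℝ) • t)) := by
  have h1 : Integrable fun t => (f : E → ℂ) (x + (2⁻¹ : ℝ) • t) :=
    (f.memM1.2.comp_add_left x).comp_smul (R := (2⁻¹ : ℝ)) (by norm_num)
  have hg := g.memM1.1
  refine h1.mul_bdd (c := ‖g‖) ?_ (.of_forall fun t => ?_)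
  · exact (show Continuous fun t => conj ((g : E → ℂ) (x - (2⁻¹ : ℝ) • t)) from
      Complex.continuous_conj.comp (by fun_prop)).aestronglyMeasurable
  · rw [RCLike.norm_conj]; exact g.memM1.norm_apply_le _

/-- The symplectic Fourier transform of a cross-Wigner distribution is a dilated cross-Wigner
distribution, with one of the functions reflected. -/
lemma symplFourierFun_wigner (f g : M1 E)
    (hW : Integrable (wigner (f : E → ℂ) (g : E → ℂ))) (z : Phase E) :
    2 ^ Module.finrank ℝ E * symplFourierFun (wigner (f : E → ℂ) (g : E → ℂ)) ((2 : ℝ) • z)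
      = wigner (f : E → ℂ) (M1.parity g : E → ℂ) z := by
  have hf := f.memM1.1
  have hg := g.memM1.1
  have hmp := WithLp.volume_preserving_toLp E E
  have hme : MeasurableEmbedding (@WithLp.toLp 2 (E × E)) :=
    (MeasurableEquiv.toLp 2 (E × E)).measurableEmbedding
  have h1 : symplFourierFun (wigner (f : E → ℂ) (g : E → ℂ)) ((2 : ℝ) • z)
      = ∫ p : E × E, wigner (f : E → ℂ) (g : E → ℂ) (WithLp.toLp 2 p) *
          chr ((2 : ℝ) • z.fst) p.2 * chr ((2 : ℝ) • z.snd) (-p.1) := by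
    rw [symplFourierFun, ← hmp.integral_comp hme]
    refine integral_congr_ae (.of_forall fun p => ?_)
    simp only [chr, mul_assoc, ← Complex.exp_add, ← add_mul]
    congr 3
    rw [← Complex.ofReal_add]
    congr 1
    simp only [sympl, WithLp.toLp_fst, WithLp.toLp_snd, WithLp.smul_fst, WithLp.smul_snd,
      inner_neg_right, real_inner_comm p.1]
    ring
  have hWp : Integrable fun p : E × E => wigner (f : E → ℂ) (g : E → ℂ) (WithLp.toLp 2 p) :=
    hmp.integrable_comp_of_integrable hW
  have hWi : Integrable fun p : E × E => wigner (f : E → ℂ) (g : E → ℂ) (WithLp.toLp 2 p) *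
      chr ((2 : ℝ) • z.fst) p.2 * chr ((2 : ℝ) • z.snd) (-p.1) := by
    simp only [mul_assoc]
    refine hWp.mul_bdd (c := 1) ?_ (.of_forall fun p => by simp [norm_chr])
    exact (show Continuous fun p : E × E =>
      chr ((2 : ℝ) • z.fst) p.2 * chr ((2 : ℝ) • z.snd) (-p.1) from
      Continuous.mul (by fun_prop) (by fun_prop)).aestronglyMeasurable
  -- In ω the Wigner distribution is a Fourier transform in t, so for almost every x the ω-integral
  -- is Fourier inversion at t = 2 z.fst.
  have h2 : ∀ᵐ x : E, ∫ ω, wigner (f : E → ℂ) (g : E → ℂ) (WithLp.toLp 2 (x, ω)) *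
      chr ((2 : ℝ) • z.fst) ω * chr ((2 : ℝ) • z.snd) (-x)
      = (f : E → ℂ) (x + z.fst) * conj ((g : E → ℂ) (x - z.fst)) *
        chr ((2 : ℝ) • z.snd) (-x) := by
    filter_upwards [hWp.prod_right_ae] with x hx
    rw [integral_mul_const]
    congr 1
    have hc : Continuous fun t =>
        (f : E → ℂ) (x + (2⁻¹ : ℝ) • t) * conj ((g : E → ℂ) (x - (2⁻¹ : ℝ) • t)) :=
      Continuous.mul (by fun_prop) (Complex.continuous_conj.comp (by fun_prop))
    have e : 𝓕 (fun t =>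
        (f : E → ℂ) (x + (2⁻¹ : ℝ) • t) * conj ((g : E → ℂ) (x - (2⁻¹ : ℝ) • t)))
        = fun ω => wigner (f : E → ℂ) (g : E → ℂ) (WithLp.toLp 2 (x, ω)) := by
      ext ω
      rw [wigner_eq_integral_chr, fourier_eq_chr]
      rfl
    have h3 := congrFun (hc.fourierInv_fourier_eq (integrable_wigner_integrand f g x)
      (by rw [e]; exact hx)) ((2 : ℝ) • z.fst)
    rw [e, Real.fourierInv_eq'] at h3
    simp only [smul_smul] at h3
    norm_num at h3
    rw [← h3]
    refine integral_congr_ae (.of_forall fun ω => ?_)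
    simp only [chr, inner_smul_right, real_inner_comm ω]
    rw [mul_comm]
    congr 3
    simp
  rw [h1, Measure.volume_eq_prod, integral_prod _ hWi, integral_congr_ae h2]
  -- Substituting x = t/2 absorbs the factor 2^d; then g(t/2 - z.fst) is the reflected g at z.fst -
  -- t/2, which is where P enters.
  have h4 := Measure.integral_comp_inv_smul (volume : Measure E) (fun x =>
    (f : E → ℂ) (x + z.fst) * conj ((g : E → ℂ) (x - z.fst)) * chr ((2 : ℝ) • z.snd) (-x)) 2
  rw [abs_of_pos (by positivity), Complex.real_smul] at h4
  push_cast at h4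
  rw [← h4, wigner_eq_integral_chr]
  refine integral_congr_ae (.of_forall fun t => ?_)
  simp only [M1.parity_apply, neg_sub, add_comm z.fst]
  congr 1
  simp [chr, inner_smul_left, inner_smul_right]

lemma symplFourierDouble_wigner {f g : M1 E} {Φ : M1 (Phase E)}
    (h : ∀ z, (Φ : Phase E → ℂ) z = wigner (g : E → ℂ) f z) (z : Phase E) :
    (symplFourierDouble Φ : Phase E → ℂ) z = wigner (g : E → ℂ) (M1.parity f : E → ℂ) z := by
  have e : (Φ : Phase E → ℂ) = wigner (g : E → ℂ) f := funext h
  rw [symplFourierDouble_apply, e, symplFourierFun_wigner g f (e ▸ Φ.memM1.2)]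

/-! ### Composition of operators with the parity operator -/

lemma M1.parity_parity (f : M1 E) : M1.parity (M1.parity f) = f := by
  ext t; simp

lemma IsWeylSymbol.comp_parity {S : M1 E →L[ℂ] MInf E} {σ : MInf (Phase E)}
    (hσ : IsWeylSymbol S σ) :
    IsWeylSymbol (S.comp M1.parity) (dualOp symplFourierDouble σ) := fun f g _ h =>
  hσ (M1.parity f) g _ (symplFourierDouble_wigner h)

lemma M1.norm_parity (f : M1 E) : ‖M1.parity f‖ = ‖f‖ :=
  (f.2.comp_isometry (LinearIsometryEquiv.neg ℝ)).2

lemma comp_parity_comp_parity (S : M1 E →L[ℂ] MInf E) :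
    (S.comp M1.parity).comp M1.parity = S := by
  ext f : 1
  simp [M1.parity_parity]

lemma norm_comp_parity_le (S : M1 E →L[ℂ] MInf E) : ‖S.comp M1.parity‖ ≤ ‖S‖ :=
  ContinuousLinearMap.opNorm_le_bound _ S.opNorm_nonneg fun f => by
    rw [← M1.norm_parity f]; exact S.le_opNorm _

/-- The linear isometry `S ↦ S P` of `𝓜^∞` onto itself. -/
def OpMInf.parity : OpMInf E ≃ₗᵢ[ℂ] OpMInf E where
  toFun S := ⟨S.1.comp M1.parity, _, S.2.choose_spec.comp_parity⟩
  invFun S := ⟨S.1.comp M1.parity, _, S.2.choose_spec.comp_parity⟩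
  map_add' _ _ := rfl
  map_smul' _ _ := rfl
  left_inv S := Subtype.ext (comp_parity_comp_parity S.1)
  right_inv S := Subtype.ext (comp_parity_comp_parity S.1)
  norm_map' S := by
    refine le_antisymm (norm_comp_parity_le S.1) ?_
    have h := norm_comp_parity_le (S.1.comp M1.parity)
    rwa [comp_parity_comp_parity] at h

lemma OpMInf.coe_parity (S : OpMInf E) : (OpMInf.parity S).1 = S.1.comp M1.parity := rfl

lemma OpMInf.parity_parity (S : OpMInf E) : OpMInf.parity (OpMInf.parity S) = S :=
  Subtype.ext (comp_parity_comp_parity S.1)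

/-- The phase e^{-2πi (w₁/2)·(w₂/2)} of the adjoint is exactly the normalising phase of β_w. -/
lemma parity_tfShiftAdj (w : Phase E) (f : M1 E) :
    M1.parity (tfShiftAdj ((2⁻¹ : ℝ) • w) f)
      = Complex.exp ((-π * inner ℝ w.fst w.snd / 2 : ℝ) * Complex.I) •
        tfShift ((2⁻¹ : ℝ) • w) (M1.parity f) := by
  have h : tfShiftAdj ((2⁻¹ : ℝ) • w) f
      = Complex.exp ((-π * inner ℝ w.fst w.snd / 2 : ℝ) * Complex.I) •
        tfShift (-((2⁻¹ : ℝ) • w)) f := by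
    have e : -2 * π * inner ℝ ((2⁻¹ : ℝ) • w).fst ((2⁻¹ : ℝ) • w).snd
        = -π * inner ℝ w.fst w.snd / 2 := by
      simp only [WithLp.smul_fst, WithLp.smul_snd, inner_smul_left, inner_smul_right]
      simp
      ring
    rw [tfShiftAdj, e]
    rfl
  rw [h, map_smul]
  congr 1
  ext t
  simp only [M1.parity_apply, tfShift_apply, WithLp.neg_fst, WithLp.neg_snd, chr_neg_left,
    neg_neg]
  congr 2
  rw [sub_neg_eq_add, neg_sub, neg_add_eq_sub]

lemma opTranslate_comp_parity (w : Phase E) (S : M1 E →L[ℂ] MInf E) :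
    opTranslate ((2⁻¹ : ℝ) • w) (S.comp M1.parity) = (opModulate w S).comp M1.parity := by
  ext f : 1
  simp only [opTranslate, opModulate, ContinuousLinearMap.comp_apply, parity_tfShiftAdj, map_smul,
    smul_apply]

/-- Right composition with P is injective, so the identity α_{w/2}(SP) = β_w(S)P transfers
invariance in both directions. No lattice structure of L enters. -/
lemma isTranslationInvariant_comp_parity (L : Set (Phase E)) (S : M1 E →L[ℂ] MInf E) :
    IsTranslationInvariant ((2⁻¹ : ℝ) • L) (S.comp M1.parity) ↔ IsModulationInvariant L S := by
  have h : ∀ w, (opModulate w S).comp M1.parity = S.comp M1.parity ↔ opModulate w S = S :=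
    fun w => ⟨fun h => by
      rw [← comp_parity_comp_parity (opModulate w S), h, comp_parity_comp_parity],
      fun h => by rw [h]⟩
  simp only [IsTranslationInvariant, IsModulationInvariant, ← Set.image_smul, Set.forall_mem_image,
    opTranslate_comp_parity, h]

lemma OpMInf.weylSymbol_parity (S : OpMInf E) :
    weylSymbol (OpMInf.parity S) = dualOp symplFourierDouble (weylSymbol S) :=
  (isWeylSymbol_weylSymbol _).unique (isWeylSymbol_weylSymbol S).comp_parity

/-- Moved to the test function, dilation and F_Ω combine to 2^d D, and the symbol of SP contributes
a second D. These cancel, and 2^{-2d} from the dilation times 2^d leaves 2^{-d}. -/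
lemma OpMInf.dilateTwo_fourierWigner_parity (S : OpMInf E) :
    dilateTwo (fourierWigner (OpMInf.parity S))
      = ((2 : ℂ) ^ Module.finrank ℝ E)⁻¹ • weylSymbol S := by
  ext Φ
  have h : dilateTwo (fourierWigner (OpMInf.parity S)) Φ
      = ((2 : ℂ) ^ Module.finrank ℝ (Phase E))⁻¹ *
        weylSymbol (OpMInf.parity S) (symplFourierM1 (M1.half Φ)) := rfl
  rw [h, OpMInf.weylSymbol_parity, dualOp_apply, symplFourierM1_half, map_smul, map_smulₛₗ,
    symplFourierDouble_symplFourierDouble, finrank_phase, two_mul, pow_add, smul_apply]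
  simp only [map_pow, Complex.conj_ofNat, smul_eq_mul]
  field_simp

end WeylCalculus

end

theorem theorem6p4 (d : ℕ) :
    ∃ Θ : OpMInf (EuclideanSpace ℝ (Fin d)) ≃ₗᵢ[ℂ] OpMInf (EuclideanSpace ℝ (Fin d)),
      (∀ S : OpMInf (EuclideanSpace ℝ (Fin d)), (Θ S).1 = S.1.comp M1.parity) ∧
      (∀ S : OpMInf (EuclideanSpace ℝ (Fin d)), Θ (Θ S) = S) ∧
      (∀ (Λ : Submodule ℤ (Phase (EuclideanSpace ℝ (Fin d)))) [DiscreteTopology Λ]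
        [IsZLattice ℝ Λ],
        Θ '' {S : OpMInf (EuclideanSpace ℝ (Fin d)) |
            IsModulationInvariant (Λ : Set (Phase (EuclideanSpace ℝ (Fin d)))) S.1}
          = {T : OpMInf (EuclideanSpace ℝ (Fin d)) | IsTranslationInvariant
            ((2⁻¹ : ℝ) • (Λ : Set (Phase (EuclideanSpace ℝ (Fin d))))) T.1} ∧
        Θ '' {T : OpMInf (EuclideanSpace ℝ (Fin d)) | IsTranslationInvariant
            ((2⁻¹ : ℝ) • (Λ : Set (Phase (EuclideanSpace ℝ (Fin d))))) T.1}
          = {S : OpMInf (EuclideanSpace ℝ (Fin d)) |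
            IsModulationInvariant (Λ : Set (Phase (EuclideanSpace ℝ (Fin d)))) S.1}) ∧
      (∀ S : OpMInf (EuclideanSpace ℝ (Fin d)),
        dilateTwo (fourierWigner (Θ S)) = ((2 : ℂ) ^ d)⁻¹ • weylSymbol S) := by
  refine ⟨OpMInf.parity, OpMInf.coe_parity, OpMInf.parity_parity, fun Λ _ _ => ?_, fun S => ?_⟩
  · have h : ∀ S : OpMInf (EuclideanSpace ℝ (Fin d)), IsTranslationInvariant
        ((2⁻¹ : ℝ) • (Λ : Set (Phase (EuclideanSpace ℝ (Fin d))))) (OpMInf.parity S).1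
        ↔ IsModulationInvariant (Λ : Set (Phase (EuclideanSpace ℝ (Fin d)))) S.1 :=
      fun S => isTranslationInvariant_comp_parity _ S.1
    refine ⟨Set.Subset.antisymm ?_ fun T hT => ?_, Set.Subset.antisymm ?_ fun S hS => ?_⟩
    · rintro _ ⟨S, hS, rfl⟩
      exact (h S).2 hS
    -- As Θ is an involution, the preimage of T is ΘT.
    · refine ⟨OpMInf.parity T, (h _).1 ?_, OpMInf.parity_parity T⟩
      rwa [OpMInf.parity_parity]
    · rintro _ ⟨T, hT, rfl⟩
      refine (h _).1 ?_
      rwa [OpMInf.parity_parity]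
    · exact ⟨OpMInf.parity S, (h S).2 hS, OpMInf.parity_parity S⟩
  · simpa using OpMInf.dilateTwo_fourierWigner_parity S
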